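/- Let $N\ge 1$, let $\Omega\subset\mathbb R^N$ be a bounded open set, and let $j:\Omega\times\mathbb R\to\mathbb R$ be such that $j(\cdot,s)$ is (Lebesgue) measurable for every $s\in\mathbb R$, $j(x,\cdot)$ is lower semicontinuous for a.e. $x\in\Omega$, and $$a(x)-c|s|^2\le j(x,s)\qquad\text{for a.e. }x\in\Omega\text{ and all }s\in\mathbb R,$$ for some $a\in L^1(\Omega)$ and $c\ge 0$. Let $\psi:\mathbb R\to[0,\infty]$ be convex and lower semicontinuous, with $\{s\in\mathbb R:\psi(s)<\infty\}\subset[0,\infty)$ and $\lim_{s\to\infty}\psi(s)/s=\infty$. Then, for every $f\in H^{-1}(\Omega)=(H^1_0(\Omega))'$, the problem $$\min\int_\Omega\big(j(x,u)+\psi(m)\big)\,dx\quad\text{subject to}\quad -\Delta u+mu=f\ \text{in }\Omega,\quad u\in H^1_0(\Omega),\quad m\in L^1(\Omega),\quad m\ge 0\ \text{a.e. in }\Omega,$$ has at least one solution $\hat m\in L^1(\Omega)$; that is, there is an admissible pair $(\hat m,\hat u)$ whose cost is at most the cost of every admissible pair $(m,u)$. The state equation is understood in the variational sense: with $L^2_m(\Omega)=\{w:\int_\Omega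 m w^2\,dx<\infty\}$, $$u\in H^1_0(\Omega)\cap L^2_m(\Omega),\qquad \int_\Omega\big(\nabla u\cdot\nabla v+muv\big)\,dx=\langle f,v\rangle\quad\text{for all }v\in H^1_0(\Omega)\cap L^2_m(\Omega).$$ The cost takes values in $(-\infty,\infty]$; it is the Lebesgue integral whenever $x\mapsto j(x,u(x))$ is measurable (for instance for every $u$ if $j$ is jointly measurable), and the upper integral (the infimum of the integrals of the measurable functions above the integrand) otherwise. -/

import Mathlib

open MeasureTheory Set Filter Topology
open scoped ENNReal NNReal ContDiff

namespace OptPot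

/-- `ℝ^N` with its Euclidean norm. -/
abbrev Eucl (N : ℕ) : Type := EuclideanSpace ℝ (Fin N)

/-- Lebesgue measure on `Ω`. -/
noncomputable abbrev leb {N : ℕ} (Ω : Set (Eucl N)) : Measure (Eucl N) :=
  (volume : Measure (Eucl N)).restrict Ω

/-- The Hilbert space `L²(Ω) × L²(Ω)^N`, with the norm `(‖u‖² + ‖G‖²)^{1/2}`. On the pairs `(u, ∇u)`
this is the norm of `H¹(Ω)`. -/
abbrev L2Pair {N : ℕ} (Ω : Set (Eucl N)) : Type :=
  WithLp 2 (Lp ℝ 2 (leb Ω) × Lp (Eucl N) 2 (leb Ω))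

/-- `φ ∈ C_c^∞(Ω)`. -/
structure IsTest {N : ℕ} (Ω : Set (Eucl N)) (φ : Eucl N → ℝ) : Prop where
  smooth : ContDiff ℝ ∞ φ
  compact : HasCompactSupport φ
  supp : tsupport φ ⊆ Ω

/-- The linear space of the pairs `(φ, ∇φ)`, for `φ ∈ C_c^∞(Ω)`, in `L²(Ω) × L²(Ω)^N`. -/
noncomputable def testPairs {N : ℕ} (Ω : Set (Eucl N)) : Submodule ℝ (L2Pair Ω) where
  carrier := {p | ∃ φ : Eucl N → ℝ, IsTest Ω φ ∧ p.fst =ᵐ[leb Ω] φ ∧ p.snd =ᵐ[leb Ω] gradient φ}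
  zero_mem' := by
    refine ⟨fun _ => 0, ⟨contDiff_const, HasCompactSupport.zero, by simp [tsupport]⟩, ?_, ?_⟩
    · exact Lp.coeFn_zero _ _ _
    · filter_upwards [Lp.coeFn_zero (Eucl N) 2 (leb Ω)] with x hx
      simpa [gradient_fun_const] using hx
  add_mem' := by
    rintro p q ⟨φ, hφ, h1, h2⟩ ⟨χ, hχ, h3, h4⟩
    refine ⟨φ + χ, ⟨hφ.smooth.add hχ.smooth, hφ.compact.add hχ.compact,
      (tsupport_add φ χ).trans (union_subset hφ.supp hχ.supp)⟩, ?_, ?_⟩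
    · filter_upwards [Lp.coeFn_add p.fst q.fst, h1, h3] with x hx h1 h3
      simp only [WithLp.add_fst, hx, Pi.add_apply, h1, h3]
    · filter_upwards [Lp.coeFn_add p.snd q.snd, h2, h4] with x hx h2 h4
      simp only [WithLp.add_snd, hx, Pi.add_apply, h2, h4, gradient]
      rw [fderiv_add (hφ.smooth.differentiable (by simp) x)
        (hχ.smooth.differentiable (by simp) x), map_add]
  smul_mem' := by
    rintro c p ⟨φ, hφ, h1, h2⟩
    refine ⟨c • φ, ⟨hφ.smooth.const_smul c, hφ.compact.smul_left (f := fun _ => c),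
      (tsupport_smul_subset_right (fun _ => c) φ).trans hφ.supp⟩, ?_, ?_⟩
    · filter_upwards [Lp.coeFn_smul c p.fst, h1] with x hx h1
      simp only [WithLp.smul_fst, hx, Pi.smul_apply, h1]
    · filter_upwards [Lp.coeFn_smul c p.snd, h2] with x hx h2
      simp only [WithLp.smul_snd, hx, Pi.smul_apply, h2, gradient]
      rw [fderiv_const_smul (hφ.smooth.differentiable (by simp) x), map_smul]

/-- `H¹₀(Ω)`: the closure of `C_c^∞(Ω)` in the norm of `H¹(Ω)`. An element is kept together with its
weak gradient, as the pair `(u, ∇u)`; see `weak_gradient` and `fn_injective` below. -/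
noncomputable def H10 {N : ℕ} (Ω : Set (Eucl N)) : Submodule ℝ (L2Pair Ω) :=
  (testPairs Ω).topologicalClosure

/-- `H⁻¹(Ω)`: the topological dual of `H¹₀(Ω)`. -/
abbrev Hminus1 {N : ℕ} (Ω : Set (Eucl N)) : Type := StrongDual ℝ (H10 Ω)

/-- (A representative of) the function `u ∈ H¹₀(Ω)`. -/
noncomputable def fn {N : ℕ} {Ω : Set (Eucl N)} (u : H10 Ω) : Eucl N → ℝ :=
  (u : L2Pair Ω).fst

/-- (A representative of) the weak gradient of `u ∈ H¹₀(Ω)`. -/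
noncomputable def grad {N : ℕ} {Ω : Set (Eucl N)} (u : H10 Ω) : Eucl N → Eucl N :=
  (u : L2Pair Ω).snd

/-- The second component of an element of `H¹₀(Ω)` is the weak gradient of the first one. -/
theorem weak_gradient {N : ℕ} {Ω : Set (Eucl N)} (u : H10 Ω) (χ : Eucl N → ℝ) (hχ : IsTest Ω χ)
    (y : Eucl N) :
    ∫ x, fn u x * fderiv ℝ χ x y ∂(leb Ω) = -∫ x, inner ℝ (grad u x) y * χ x ∂(leb Ω) := by
  have hdc : Continuous fun x => fderiv ℝ χ x y :=
    (hχ.smooth.continuous_fderiv (by simp)).clm_apply continuous_const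
  have hds : HasCompactSupport fun x => fderiv ℝ χ x y := hχ.compact.fderiv_apply (𝕜 := ℝ) y
  have hX : MemLp (fun x => fderiv ℝ χ x y) 2 (leb Ω) :=
    (hdc.memLp_of_hasCompactSupport hds).restrict Ω
  have hY : MemLp (fun x => χ x • y) 2 (leb Ω) :=
    ((hχ.smooth.continuous.smul continuous_const).memLp_of_hasCompactSupport
      hχ.compact.smul_right).restrict Ω
  have key : ∀ p : L2Pair Ω, (inner ℝ (hX.toLp _) p.fst + inner ℝ (hY.toLp _) p.snd : ℝ) =
      ∫ x, p.fst x * fderiv ℝ χ x y ∂(leb Ω) + ∫ x, inner ℝ (p.snd x) y * χ x ∂(leb Ω) := by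
    intro p
    rw [L2.inner_def, L2.inner_def]
    congr 1
    · refine integral_congr_ae ?_
      filter_upwards [hX.coeFn_toLp] with x hx
      rw [hx]; rfl
    · refine integral_congr_ae ?_
      filter_upwards [hY.coeFn_toLp] with x hx
      rw [hx, real_inner_comm, inner_smul_right, mul_comm]
  have hcl : IsClosed {p : L2Pair Ω |
      (inner ℝ (hX.toLp _) p.fst + inner ℝ (hY.toLp _) p.snd : ℝ) = 0} := by
    refine isClosed_eq ?_ continuous_const
    exact (continuous_const.inner (WithLp.prod_continuous_ofLp 2 _ _).fst).add
      (continuous_const.inner (WithLp.prod_continuous_ofLp 2 _ _).snd)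
  have hsub : (testPairs Ω : Set (L2Pair Ω)) ⊆ {p : L2Pair Ω |
      (inner ℝ (hX.toLp _) p.fst + inner ℝ (hY.toLp _) p.snd : ℝ) = 0} := by
    rintro p ⟨φ, hφ, h1, h2⟩
    have e1 : ∫ x, p.fst x * fderiv ℝ χ x y ∂(leb Ω) = ∫ x, φ x * fderiv ℝ χ x y := by
      rw [← setIntegral_eq_integral_of_forall_compl_eq_zero (s := Ω)
        (f := fun x => φ x * fderiv ℝ χ x y)]
      · refine integral_congr_ae ?_
        filter_upwards [h1] with x hx
        rw [hx]
      · intro x hx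
        rw [image_eq_zero_of_notMem_tsupport fun h => hx (hφ.supp h), zero_mul]
    have e2 : ∫ x, inner ℝ (p.snd x) y * χ x ∂(leb Ω) = ∫ x, fderiv ℝ φ x y * χ x := by
      rw [← setIntegral_eq_integral_of_forall_compl_eq_zero (s := Ω)
        (f := fun x => fderiv ℝ φ x y * χ x)]
      · refine integral_congr_ae ?_
        filter_upwards [h2] with x hx
        rw [hx, gradient, InnerProductSpace.toDual_symm_apply]
      · intro x hx
        rw [image_eq_zero_of_notMem_tsupport fun h => hx (hχ.supp h), mul_zero]
    have hdφ : Continuous fun x => fderiv ℝ φ x y :=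
      (hφ.smooth.continuous_fderiv (by simp)).clm_apply continuous_const
    have hib := integral_mul_fderiv_eq_neg_fderiv_mul_of_integrable (μ := volume) (f := φ) (g := χ)
      (v := y)
      ((hdφ.mul hχ.smooth.continuous).integrable_of_hasCompactSupport hχ.compact.mul_left)
      ((hφ.smooth.continuous.mul hdc).integrable_of_hasCompactSupport hds.mul_left)
      ((hφ.smooth.continuous.mul hχ.smooth.continuous).integrable_of_hasCompactSupport
        hχ.compact.mul_left)
      (fun x _ => hφ.smooth.differentiable (by simp) x)
      (fun x _ => hχ.smooth.differentiable (by simp) x)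
    simp only [mem_ofPred_eq, key, e1, e2, hib]
    ring
  have h := hcl.closure_subset_iff.2 hsub u.2
  have h' := (key u.1).symm.trans h
  exact eq_neg_of_add_eq_zero_left h'

/-- An element of `H¹₀(Ω)` is determined by the function `u` alone. -/
theorem fn_injective {N : ℕ} {Ω : Set (Eucl N)} (hΩ : IsOpen Ω) {u v : H10 Ω}
    (huv : fn u =ᵐ[leb Ω] fn v) : u = v := by
  have h2 : MemLp (grad u - grad v) 2 (leb Ω) :=
    (Lp.memLp (u : L2Pair Ω).snd).sub (Lp.memLp (v : L2Pair Ω).snd)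
  have hg : ∀ y : Eucl N, ∀ᵐ x ∂(leb Ω), inner ℝ ((grad u - grad v) x) y = (0 : ℝ) := by
    intro y
    have hm : MemLp (fun x => (inner ℝ ((grad u - grad v) x) y : ℝ)) 2 (leb Ω) := h2.inner_const y
    rw [ae_restrict_iff' hΩ.measurableSet]
    refine hΩ.ae_eq_zero_of_integral_contDiff_smul_eq_zero ?_ ?_
    · exact (locallyIntegrableOn_of_locallyIntegrable_restrict
        (hm.locallyIntegrable (by norm_num)))
    · intro χ h1 hc hs
      have hχ : IsTest Ω χ := ⟨h1, hc, hs⟩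
      have hu := weak_gradient u χ hχ y
      have hv := weak_gradient v χ hχ y
      have huv' : ∫ x, fn u x * fderiv ℝ χ x y ∂(leb Ω) = ∫ x, fn v x * fderiv ℝ χ x y ∂(leb Ω) := by
        refine integral_congr_ae ?_
        filter_upwards [huv] with x hx
        rw [hx]
      have hL : MemLp χ 2 (leb Ω) :=
        (h1.continuous.memLp_of_hasCompactSupport hc).restrict Ω
      have iu : Integrable (fun x => (inner ℝ (grad u x) y : ℝ) * χ x) (leb Ω) :=
        ((Lp.memLp (u : L2Pair Ω).snd).inner_const y).integrable_mul hL
      have iv : Integrable (fun x => (inner ℝ (grad v x) y : ℝ) * χ x) (leb Ω) :=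
        ((Lp.memLp (v : L2Pair Ω).snd).inner_const y).integrable_mul hL
      rw [← setIntegral_eq_integral_of_forall_compl_eq_zero (s := Ω)]
      · have : ∀ x, χ x • (inner ℝ ((grad u - grad v) x) y : ℝ) =
            inner ℝ (grad u x) y * χ x - inner ℝ (grad v x) y * χ x := by
          intro x
          simp only [Pi.sub_apply, inner_sub_left, smul_eq_mul]
          ring
        simp only [this]
        rw [integral_sub iu iv]
        linarith
      · intro x hx
        rw [image_eq_zero_of_notMem_tsupport fun h => hx (hs h), zero_smul]
  have hgrad : grad u =ᵐ[leb Ω] grad v := by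
    have := ae_all_iff.2 fun i : Fin N => hg (EuclideanSpace.single i 1)
    filter_upwards [this] with x hx
    ext i
    have := hx i
    simp [EuclideanSpace.inner_single_right] at this
    linarith
  refine Subtype.ext ((WithLp.equiv 2 _).injective (Prod.ext (Lp.ext huv) (Lp.ext hgrad)))

/-- Test functions belong to `H¹₀(Ω)`, with their classical gradient. -/
theorem test_mem {N : ℕ} {Ω : Set (Eucl N)} {φ : Eucl N → ℝ} (hφ : IsTest Ω φ) :
    ∃ u : H10 Ω, fn u =ᵐ[leb Ω] φ ∧ grad u =ᵐ[leb Ω] gradient φ := by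
  have h1 : MemLp φ 2 (leb Ω) :=
    (hφ.smooth.continuous.memLp_of_hasCompactSupport hφ.compact).restrict Ω
  have h2 : MemLp (gradient φ) 2 (leb Ω) := by
    refine (Continuous.memLp_of_hasCompactSupport ?_ ?_).restrict Ω
    · exact (LinearIsometryEquiv.continuous _).comp (hφ.smooth.continuous_fderiv (by simp))
    · exact (hφ.compact.fderiv (𝕜 := ℝ)).comp_left (map_zero _)
  exact ⟨⟨WithLp.toLp 2 (h1.toLp φ, h2.toLp (gradient φ)), subset_closure
    ⟨φ, hφ, h1.coeFn_toLp, h2.coeFn_toLp⟩⟩, h1.coeFn_toLp, h2.coeFn_toLp⟩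

/-- `w ∈ L²_m(Ω)`, the `L²` space with weight `m ≥ 0`. -/
def MemL2Weight {N : ℕ} (Ω : Set (Eucl N)) (m w : Eucl N → ℝ) : Prop :=
  Integrable (fun x => m x * w x ^ 2) (leb Ω)

/-- `u ∈ H¹₀(Ω)` solves `-Δu + m u = f`, in the variational sense. -/
def IsState {N : ℕ} (Ω : Set (Eucl N)) (f : Hminus1 Ω) (m : Eucl N → ℝ) (u : H10 Ω) : Prop :=
  MemL2Weight Ω m (fn u) ∧
    ∀ v : H10 Ω, MemL2Weight Ω m (fn v) →
      ∫ x, (inner ℝ (grad u x) (grad v x) + m x * fn u x * fn v x) ∂(leb Ω) = f v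

/-- The Lebesgue integral, with values in `[-∞, ∞]`, of a measurable extended real function whose
negative part has a finite integral. -/
noncomputable def extIntegral {α : Type*} [MeasurableSpace α] (μ : Measure α) (g : α → EReal) :
    EReal :=
  ((∫⁻ x, (g x).toENNReal ∂μ : ℝ≥0∞) : EReal) - ((∫⁻ x, (-g x).toENNReal ∂μ : ℝ≥0∞) : EReal)

/-- The upper integral: the infimum of the integrals of the measurable functions that are above `g`.
It is the Lebesgue integral if `g` is measurable, see `upperIntegral_eq`. (If `j` is only measurable
in `x` and lower semicontinuous in `s`, then `x ↦ j(x, u(x))` need not be measurable.) -/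
noncomputable def upperIntegral {α : Type*} [MeasurableSpace α] (μ : Measure α) (g : α → EReal) :
    EReal :=
  ⨅ (h : α → EReal) (_ : Measurable h) (_ : g ≤ᵐ[μ] h), extIntegral μ h

/-- The cost `∫_Ω (j(x, u) + ψ(m)) dx`. -/
noncomputable def cost {N : ℕ} (Ω : Set (Eucl N)) (j : Eucl N → ℝ → ℝ) (ψ : ℝ → ℝ≥0∞)
    (u : H10 Ω) (m : Eucl N → ℝ) : EReal :=
  upperIntegral (leb Ω) (fun x => ((j x (fn u x) : ℝ) : EReal) + ((ψ (m x) : ℝ≥0∞) : EReal))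

/-- `(m, u)` is admissible: `m ∈ L¹(Ω)`, `m ≥ 0` a.e. in `Ω`, and `u ∈ H¹₀(Ω)` solves
`-Δu + m u = f`. -/
def IsAdmissible {N : ℕ} (Ω : Set (Eucl N)) (f : Hminus1 Ω) (m : Eucl N → ℝ) (u : H10 Ω) : Prop :=
  Integrable m (leb Ω) ∧ (∀ᵐ x ∂(leb Ω), 0 ≤ m x) ∧ IsState Ω f m u

/-- `m` solves the optimal potential problem: it has a state `u`, and the pair `(m, u)` minimizes
the cost among all admissible pairs. -/
def IsOptimalPotential {N : ℕ} (Ω : Set (Eucl N)) (j : Eucl N → ℝ → ℝ) (ψ : ℝ → ℝ≥0∞)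
    (f : Hminus1 Ω) (m : Eucl N → ℝ) : Prop :=
  ∃ u : H10 Ω, IsAdmissible Ω f m u ∧
    ∀ (m' : Eucl N → ℝ) (u' : H10 Ω), IsAdmissible Ω f m' u' →
      cost Ω j ψ u m ≤ cost Ω j ψ u' m'

theorem extIntegral_mono {α : Type*} [MeasurableSpace α] {μ : Measure α} {g h : α → EReal}
    (hgh : g ≤ᵐ[μ] h) : extIntegral μ g ≤ extIntegral μ h := by
  refine EReal.sub_le_sub ?_ ?_
  · refine EReal.coe_ennreal_le_coe_ennreal_iff.2 (lintegral_mono_ae ?_)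
    filter_upwards [hgh] with x hx using EReal.toENNReal_le_toENNReal hx
  · refine EReal.coe_ennreal_le_coe_ennreal_iff.2 (lintegral_mono_ae ?_)
    filter_upwards [hgh] with x hx using
      EReal.toENNReal_le_toENNReal (EReal.neg_le_neg_iff.2 hx)

theorem upperIntegral_eq {α : Type*} [MeasurableSpace α] {μ : Measure α} {g : α → EReal}
    (hg : AEMeasurable g μ) : upperIntegral μ g = extIntegral μ g := by
  refine le_antisymm ?_ ?_
  · refine (iInf₂_le_of_le (hg.mk g) hg.measurable_mk
      (iInf_le_of_le hg.ae_eq_mk.le le_rfl)).trans ?_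
    exact extIntegral_mono hg.ae_eq_mk.symm.le
  · exact le_iInf fun h => le_iInf fun _ => le_iInf fun hle => extIntegral_mono hle

end OptPot

namespace OptPot

section Hilbert

variable {H : Type*} [NormedAddCommGroup H] [InnerProductSpace ℝ H]

theorem norm_weak_limit_le {ι : Type*} {l : Filter ι} [l.NeBot] {u : ι → H} {x : H} {C : ℝ}
    (hu : ∀ n, ‖u n‖ ≤ C)
    (h : ∀ v : H, Tendsto (fun n => (inner ℝ v (u n) : ℝ)) l (𝓝 (inner ℝ v x))) : ‖x‖ ≤ C := by
  have h1 : (inner ℝ x x : ℝ) ≤ ‖x‖ * C :=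
    le_of_tendsto (h x) (Eventually.of_forall fun n =>
      (real_inner_le_norm x (u n)).trans (mul_le_mul_of_nonneg_left (hu n) (norm_nonneg x)))
  rw [real_inner_self_eq_norm_mul_norm] at h1
  rcases (norm_nonneg x).eq_or_lt with h0 | h0
  · obtain ⟨n⟩ := l.nonempty_of_neBot
    exact h0 ▸ (norm_nonneg (u n)).trans (hu n)
  · exact le_of_mul_le_mul_left h1 h0

variable [CompleteSpace H]

/-- The Riesz identification of a Hilbert space with its dual, with the weak-star topology. -/
noncomputable def toWeakDual (x : H) : WeakDual ℝ H :=
  StrongDual.toWeakDual (InnerProductSpace.toDual ℝ H x)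

theorem toWeakDual_apply (x v : H) : toWeakDual x v = inner ℝ x v := rfl

theorem toWeakDual_mem_closedBall {x : H} {C : ℝ} (hx : ‖x‖ ≤ C) :
    toWeakDual x ∈ WeakDual.toStrongDual ⁻¹' Metric.closedBall (0 : StrongDual ℝ H) C := by
  rw [mem_preimage, mem_closedBall_zero_iff]
  exact ((InnerProductSpace.toDual ℝ H).norm_map x).le.trans hx

theorem toWeakDual_surjective (F : WeakDual ℝ H) : ∃ x : H, toWeakDual x = F :=
  ⟨(InnerProductSpace.toDual ℝ H).symm (WeakDual.toStrongDual F), by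
    simp [toWeakDual]⟩

theorem tendsto_inner_of_toWeakDual {ι : Type*} {l : Filter ι} {u : ι → H} {x : H}
    (h : Tendsto (fun n => toWeakDual (u n)) l (𝓝 (toWeakDual x))) (v : H) :
    Tendsto (fun n => (inner ℝ v (u n) : ℝ)) l (𝓝 (inner ℝ v x)) := by
  have := (WeakDual.eval_continuous (𝕜 := ℝ) v).continuousAt.tendsto.comp h
  simp only [Function.comp_def, toWeakDual_apply] at this
  simpa only [real_inner_comm v] using this

/-- A bounded sequence of a separable Hilbert space has a weakly convergent subsequence. -/
theorem exists_subseq_weak_limit [TopologicalSpace.SeparableSpace H] {u : ℕ → H} {C : ℝ}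
    (hu : ∀ n, ‖u n‖ ≤ C) : ∃ (x : H) (φ : ℕ → ℕ), StrictMono φ ∧
      ∀ v : H, Tendsto (fun n => (inner ℝ v (u (φ n)) : ℝ)) atTop (𝓝 (inner ℝ v x)) := by
  obtain ⟨F, -, φ, hφ, h⟩ := (WeakDual.isSeqCompact_closedBall ℝ H 0 C)
    (fun n => toWeakDual_mem_closedBall (hu n))
  obtain ⟨x, rfl⟩ := toWeakDual_surjective F
  exact ⟨x, φ, hφ, fun v => tendsto_inner_of_toWeakDual (u := fun n => u (φ n)) h v⟩

/-- A bounded family of a Hilbert space converges weakly along every ultrafilter. -/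
theorem exists_ultrafilter_weak_limit {ι : Type*} (U : Ultrafilter ι) {u : ι → H} {C : ℝ}
    (hu : ∀ n, ‖u n‖ ≤ C) : ∃ x : H,
      ∀ v : H, Tendsto (fun n => (inner ℝ v (u n) : ℝ)) U (𝓝 (inner ℝ v x)) := by
  obtain ⟨F, -, h⟩ := (WeakDual.isCompact_closedBall (0 : StrongDual ℝ H) C).ultrafilter_le_nhds
    (U.map fun n => toWeakDual (u n))
    (le_principal_iff.2 (mem_map.2 (Eventually.of_forall
      fun n => toWeakDual_mem_closedBall (hu n))))
  obtain ⟨x, rfl⟩ := toWeakDual_surjective F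
  exact ⟨x, fun v => tendsto_inner_of_toWeakDual (l := (U : Filter ι)) h v⟩

/-- Weak limits stay in closed convex sets. -/
theorem weak_limit_mem {ι : Type*} {l : Filter ι} [l.NeBot] {u : ι → H} {x : H} {K : Set H}
    (hK : Convex ℝ K) (hKc : IsClosed K) (hu : ∀ᶠ n in l, u n ∈ K)
    (h : ∀ v : H, Tendsto (fun n => (inner ℝ v (u n) : ℝ)) l (𝓝 (inner ℝ v x))) : x ∈ K := by
  by_contra hx
  obtain ⟨F, s, hF1, hF2⟩ := geometric_hahn_banach_closed_point hK hKc hx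
  obtain ⟨y, rfl⟩ := (InnerProductSpace.toDual ℝ H).surjective F
  simp only [InnerProductSpace.toDual_apply_apply] at hF1 hF2
  have : (inner ℝ y x : ℝ) ≤ s := le_of_tendsto (h y) (hu.mono fun n hn => (hF1 _ hn).le)
  linarith

end Hilbert

end OptPot

namespace OptPot

section Lintegral

variable {α : Type*} [MeasurableSpace α] {μ : Measure α}

theorem sq_lintegral_le_mul {g : α → ℝ≥0∞} (hg : AEMeasurable g μ) :
    (∫⁻ x, g x ∂μ) ^ 2 ≤ μ univ * ∫⁻ x, g x ^ 2 ∂μ := by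
  have h := ENNReal.lintegral_mul_le_Lp_mul_Lq μ (p := 2) (q := 2)
    (Real.HolderConjugate.two_two) (f := fun _ => 1) (g := g) aemeasurable_const hg
  simp only [Pi.mul_apply, one_mul, ENNReal.one_rpow, lintegral_const] at h
  calc (∫⁻ x, g x ∂μ) ^ 2 ≤ (μ univ ^ (1 / 2 : ℝ) * (∫⁻ x, g x ^ (2 : ℝ) ∂μ) ^ (1 / 2 : ℝ)) ^ 2 := by
        gcongr
    _ = μ univ * ∫⁻ x, g x ^ 2 ∂μ := by
        rw [mul_pow, ← ENNReal.rpow_natCast, ← ENNReal.rpow_natCast, ← ENNReal.rpow_mul,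
          ← ENNReal.rpow_mul]
        norm_num

theorem eLpNorm_two_sq {E : Type*} [NormedAddCommGroup E] (f : α → E) :
    eLpNorm f 2 μ ^ 2 = ∫⁻ x, ‖f x‖ₑ ^ 2 ∂μ := by
  have := eLpNorm_nnreal_pow_eq_lintegral (μ := μ) (f := f) (p := 2) (by norm_num)
  simpa using this

end Lintegral

variable {N : ℕ} {Ω : Set (Eucl N)}

theorem gradient_continuous {φ : Eucl N → ℝ} (hφ : IsTest Ω φ) : Continuous (gradient φ) :=
  (LinearIsometryEquiv.continuous _).comp (hφ.smooth.continuous_fderiv (by simp))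

theorem gradient_eq_zero_of_notMem {φ : Eucl N → ℝ} (hφ : IsTest Ω φ) {x : Eucl N} (hx : x ∉ Ω) :
    gradient φ x = 0 := by
  have : fderiv ℝ φ x = 0 :=
    image_eq_zero_of_notMem_tsupport fun h => hx (hφ.supp (tsupport_fderiv_subset ℝ h))
  simp [gradient, this]

theorem test_eq_zero_of_notMem {φ : Eucl N → ℝ} (hφ : IsTest Ω φ) {x : Eucl N} (hx : x ∉ Ω) :
    φ x = 0 :=
  image_eq_zero_of_notMem_tsupport fun h => hx (hφ.supp h)

theorem enorm_translate_sub_le {φ : Eucl N → ℝ} (hφ : IsTest Ω φ) (x h : Eucl N) :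
    ‖φ (x + h) - φ x‖ₑ ≤ ∫⁻ t in Ioc (0 : ℝ) 1, ‖h‖ₑ * ‖gradient φ (x + t • h)‖ₑ := by
  have hd : ∀ t : ℝ, HasDerivAt (fun t : ℝ => φ (x + t • h)) (fderiv ℝ φ (x + t • h) h) t := by
    intro t
    have h1 : HasFDerivAt φ (fderiv ℝ φ (x + t • h)) (x + t • h) :=
      (hφ.smooth.differentiable (by simp) _).hasFDerivAt
    have h2 : HasDerivAt (fun t : ℝ => x + t • h) h t := by
      simpa using ((hasDerivAt_id t).smul_const h).const_add x
    exact h1.comp_hasDerivAt t h2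
  have hc : Continuous fun t : ℝ => fderiv ℝ φ (x + t • h) h :=
    ((hφ.smooth.continuous_fderiv (by simp)).comp (by fun_prop)).clm_apply continuous_const
  have h3 := intervalIntegral.integral_eq_sub_of_hasDerivAt (a := 0) (b := 1)
    (fun t _ => hd t) (hc.intervalIntegrable 0 1)
  simp only [one_smul, zero_smul, add_zero] at h3
  rw [← h3, intervalIntegral.integral_of_le zero_le_one]
  refine (enorm_integral_le_lintegral_enorm _).trans (lintegral_mono fun t => ?_)
  have h4 : fderiv ℝ φ (x + t • h) h = inner ℝ (gradient φ (x + t • h)) h := by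
    rw [gradient, InnerProductSpace.toDual_symm_apply]
  rw [h4, mul_comm]
  simp only [enorm_eq_nnnorm]
  exact_mod_cast nnnorm_inner_le_nnnorm (𝕜 := ℝ) (gradient φ (x + t • h)) h

/-- The `L²` modulus of continuity of a test function is controlled by its gradient. -/
theorem lintegral_translate_sub_sq_le {φ : Eucl N → ℝ} (hφ : IsTest Ω φ) (h : Eucl N) :
    ∫⁻ x, ‖φ (x + h) - φ x‖ₑ ^ 2 ≤ ‖h‖ₑ ^ 2 * ∫⁻ x, ‖gradient φ x‖ₑ ^ 2 := by
  have hgc := gradient_continuous hφ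
  have hm : Measurable (Function.uncurry fun (x : Eucl N) (t : ℝ) =>
      ‖h‖ₑ ^ 2 * ‖gradient φ (x + t • h)‖ₑ ^ 2) := by
    have : Continuous (Function.uncurry fun (x : Eucl N) (t : ℝ) => gradient φ (x + t • h)) :=
      hgc.comp (by fun_prop)
    exact (this.measurable.enorm.pow_const 2).const_mul _
  calc ∫⁻ x, ‖φ (x + h) - φ x‖ₑ ^ 2
      ≤ ∫⁻ x, ∫⁻ t in Ioc (0 : ℝ) 1, ‖h‖ₑ ^ 2 * ‖gradient φ (x + t • h)‖ₑ ^ 2 := by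
        refine lintegral_mono fun x => ?_
        refine (pow_le_pow_left' (enorm_translate_sub_le hφ x h) 2).trans ?_
        refine (sq_lintegral_le_mul ?_).trans ?_
        · have : Continuous fun t : ℝ => gradient φ (x + t • h) := hgc.comp (by fun_prop)
          exact (this.measurable.enorm.const_mul _).aemeasurable
        · simp [mul_pow]
    _ = ∫⁻ t in Ioc (0 : ℝ) 1, ∫⁻ x, ‖h‖ₑ ^ 2 * ‖gradient φ (x + t • h)‖ₑ ^ 2 :=
        lintegral_lintegral_swap hm.aemeasurable
    _ = ∫⁻ t in Ioc (0 : ℝ) 1, ‖h‖ₑ ^ 2 * ∫⁻ x, ‖gradient φ x‖ₑ ^ 2 := by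
        refine lintegral_congr fun t => ?_
        rw [lintegral_add_right_eq_self (fun x => ‖h‖ₑ ^ 2 * ‖gradient φ x‖ₑ ^ 2) (t • h),
          lintegral_const_mul _ (hgc.measurable.enorm.pow_const 2)]
    _ = ‖h‖ₑ ^ 2 * ∫⁻ x, ‖gradient φ x‖ₑ ^ 2 := by simp

/-- `u` as an element of `L²(Ω)`. -/
noncomputable abbrev toL2 (u : H10 Ω) : Lp ℝ 2 (leb Ω) := (u : L2Pair Ω).fst

/-- `∇u` as an element of `L²(Ω)^N`. -/
noncomputable abbrev gradL2 (u : H10 Ω) : Lp (Eucl N) 2 (leb Ω) := (u : L2Pair Ω).snd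

theorem continuous_toL2 : Continuous (toL2 : H10 Ω → Lp ℝ 2 (leb Ω)) :=
  (WithLp.prod_continuous_ofLp 2 _ _).fst.comp continuous_subtype_val

theorem continuous_gradL2 : Continuous (gradL2 : H10 Ω → Lp (Eucl N) 2 (leb Ω)) :=
  (WithLp.prod_continuous_ofLp 2 _ _).snd.comp continuous_subtype_val

theorem norm_sq_eq (u : H10 Ω) : ‖u‖ ^ 2 = ‖toL2 u‖ ^ 2 + ‖gradL2 u‖ ^ 2 :=
  WithLp.prod_norm_sq_eq_of_L2 (u : L2Pair Ω)

theorem norm_toL2_le (u : H10 Ω) : ‖toL2 u‖ ≤ ‖u‖ :=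
  abs_le_of_sq_le_sq' (by nlinarith [norm_sq_eq u, sq_nonneg ‖gradL2 u‖]) (norm_nonneg u) |>.2

theorem norm_gradL2_le (u : H10 Ω) : ‖gradL2 u‖ ≤ ‖u‖ :=
  abs_le_of_sq_le_sq' (by nlinarith [norm_sq_eq u, sq_nonneg ‖toL2 u‖]) (norm_nonneg u) |>.2

instance separable_H10 : TopologicalSpace.SeparableSpace (H10 Ω) := by
  have : Fact ((2 : ℝ≥0∞) ≠ ⊤) := ⟨by simp⟩
  have : SecondCountableTopology (L2Pair Ω) := WithLp.secondCountableTopology 2 _ _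
  have : SecondCountableTopology (H10 Ω) :=
    TopologicalSpace.Subtype.secondCountableTopology (H10 Ω : Set (L2Pair Ω))
  infer_instance

instance complete_H10 : CompleteSpace (H10 Ω) :=
  (Submodule.isClosed_topologicalClosure (testPairs Ω)).completeSpace_coe

/-- A closed property of elements of `H¹₀(Ω)` can be checked on test functions. -/
theorem H10_induction {P : H10 Ω → Prop} (hcl : ∀ (w : ℕ → H10 Ω) (u : H10 Ω),
    Tendsto w atTop (𝓝 u) → (∀ n, P (w n)) → P u)
    (htest : ∀ (w : H10 Ω) (φ : Eucl N → ℝ), IsTest Ω φ → fn w =ᵐ[leb Ω] φ →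
      grad w =ᵐ[leb Ω] gradient φ → P w) (u : H10 Ω) : P u := by
  obtain ⟨p, hp, hlim⟩ := mem_closure_iff_seq_limit.1 u.2
  refine hcl (fun n => ⟨p n, subset_closure (hp n)⟩) u (tendsto_subtype_rng.2 hlim) fun n => ?_
  obtain ⟨φ, hφ, h1, h2⟩ := hp n
  exact htest _ φ hφ h1 h2

theorem enorm_toL2_sq (u : H10 Ω) : ‖toL2 u‖ₑ ^ 2 = ∫⁻ x, ‖fn u x‖ₑ ^ 2 ∂(leb Ω) := by
  rw [Lp.enorm_def, eLpNorm_two_sq]; rfl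

theorem enorm_gradL2_sq (u : H10 Ω) : ‖gradL2 u‖ₑ ^ 2 = ∫⁻ x, ‖grad u x‖ₑ ^ 2 ∂(leb Ω) := by
  rw [Lp.enorm_def, eLpNorm_two_sq]; rfl

theorem enorm_gradL2_sq_of_test {w : H10 Ω} {φ : Eucl N → ℝ} (hφ : IsTest Ω φ)
    (h : grad w =ᵐ[leb Ω] gradient φ) : ‖gradL2 w‖ₑ ^ 2 = ∫⁻ x, ‖gradient φ x‖ₑ ^ 2 := by
  rw [enorm_gradL2_sq, lintegral_congr_ae (g := fun x => ‖gradient φ x‖ₑ ^ 2)]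
  · refine setLIntegral_eq_of_support_subset fun x hx => ?_
    by_contra hxΩ
    exact hx (by simp [gradient_eq_zero_of_notMem hφ hxΩ])
  · filter_upwards [h] with x hx
    rw [hx]

/-- The Poincaré inequality. -/
theorem norm_toL2_le_mul (hΩ : MeasurableSet Ω) {h : Eucl N} (hh : ∀ x ∈ Ω, x + h ∉ Ω)
    (u : H10 Ω) : ‖toL2 u‖ ≤ ‖h‖ * ‖gradL2 u‖ := by
  refine H10_induction (P := fun u => ‖toL2 u‖ ≤ ‖h‖ * ‖gradL2 u‖) ?_ ?_ u
  · intro w u hw hle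
    exact le_of_tendsto_of_tendsto' ((continuous_toL2.tendsto u).comp hw).norm
      (((continuous_gradL2.tendsto u).comp hw).norm.const_mul _) hle
  · intro w φ hφ h1 h2
    have key : ‖toL2 w‖ₑ ^ 2 ≤ (‖h‖ₑ * ‖gradL2 w‖ₑ) ^ 2 := by
      rw [mul_pow, enorm_gradL2_sq_of_test hφ h2, enorm_toL2_sq]
      refine le_trans ?_ (lintegral_translate_sub_sq_le hφ h)
      refine le_trans (le_of_eq ?_) (setLIntegral_le_lintegral Ω _)
      refine lintegral_congr_ae ?_
      filter_upwards [h1, ae_restrict_mem hΩ] with x hx hxΩ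
      rw [hx, test_eq_zero_of_notMem hφ (hh x hxΩ), zero_sub, enorm_neg]
    have key2 : ‖toL2 w‖ₑ ≤ ‖h‖ₑ * ‖gradL2 w‖ₑ := (ENNReal.pow_le_pow_left_iff two_ne_zero).1 key
    have key3 : ‖toL2 w‖₊ ≤ ‖h‖₊ * ‖gradL2 w‖₊ := by
      simp only [enorm_eq_nnnorm] at key2
      exact_mod_cast key2
    exact_mod_cast key3

theorem exists_poincare (hN : 1 ≤ N) (hΩ : MeasurableSet Ω) (hΩb : Bornology.IsBounded Ω) :
    ∃ K : ℝ, 1 ≤ K ∧ ∀ u : H10 Ω, ‖u‖ ^ 2 ≤ K * ‖gradL2 u‖ ^ 2 := by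
  obtain ⟨R, hR⟩ := hΩb.exists_norm_le
  set h : Eucl N := EuclideanSpace.single ⟨0, hN⟩ (2 * |R| + 1)
  have hn : ‖h‖ = 2 * |R| + 1 := by
    simp only [h, PiLp.norm_single, Real.norm_eq_abs]
    exact abs_of_pos (by positivity)
  have hh : ∀ x ∈ Ω, x + h ∉ Ω := by
    intro x hx hxh
    have h1 := hR x hx
    have h2 := hR _ hxh
    have h3 : ‖h‖ ≤ ‖x + h‖ + ‖x‖ := by simpa using norm_sub_le (x + h) x
    have := le_abs_self R
    linarith
  refine ⟨‖h‖ ^ 2 + 1, by nlinarith [sq_nonneg ‖h‖], fun u => ?_⟩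
  have h1 := pow_le_pow_left₀ (norm_nonneg _) (norm_toL2_le_mul hΩ hh u) 2
  rw [norm_sq_eq]
  nlinarith

end OptPot

namespace OptPot

variable {N : ℕ} {Ω : Set (Eucl N)}

/-- The average over the ball `B(x, ε)` of the extension by zero of a function on `Ω`. -/
noncomputable def ballAvg (Ω : Set (Eucl N)) (ε : ℝ) (g : Eucl N → ℝ) (x : Eucl N) : ℝ :=
  (volume.real (Metric.ball (0 : Eucl N) ε))⁻¹ * ∫ y in Metric.ball x ε, g y ∂(leb Ω)

theorem stronglyMeasurable_ballAvg {ε : ℝ} {g : Eucl N → ℝ} (hg : StronglyMeasurable g) :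
    StronglyMeasurable (ballAvg Ω ε g) := by
  have hS : MeasurableSet {p : Eucl N × Eucl N | dist p.2 p.1 < ε} :=
    (isOpen_lt (continuous_snd.dist continuous_fst) continuous_const).measurableSet
  have h1 : StronglyMeasurable (Function.uncurry fun x y : Eucl N =>
      (Metric.ball x ε).indicator g y) := by
    have : (Function.uncurry fun x y : Eucl N => (Metric.ball x ε).indicator g y) =
        {p : Eucl N × Eucl N | dist p.2 p.1 < ε}.indicator (fun p => g p.2) := by
      ext ⟨x, y⟩
      simp only [Function.uncurry, indicator, Metric.mem_ball, mem_ofPred_eq]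
    rw [this]
    exact (hg.comp_measurable measurable_snd).indicator hS
  have h2 : ballAvg Ω ε g = fun x => (volume.real (Metric.ball (0 : Eucl N) ε))⁻¹ *
      ∫ y, (Metric.ball x ε).indicator g y ∂(leb Ω) := by
    ext x
    rw [ballAvg, integral_indicator Metric.isOpen_ball.measurableSet]
  rw [h2]
  exact h1.integral_prod_right.const_mul _

theorem ballAvg_test {φ : Eucl N → ℝ} (hφ : IsTest Ω φ) (ε : ℝ) (x : Eucl N) :
    ballAvg Ω ε φ x = (volume.real (Metric.ball (0 : Eucl N) ε))⁻¹ *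
      ∫ h in Metric.ball (0 : Eucl N) ε, φ (x + h) := by
  have hB : MeasurableSet (Metric.ball x ε) := Metric.isOpen_ball.measurableSet
  have h1 : ∫ y in Metric.ball x ε, φ y ∂(leb Ω) = ∫ y in Metric.ball x ε, φ y := by
    rw [Measure.restrict_restrict hB]
    refine (setIntegral_eq_of_subset_of_forall_sdiff_eq_zero hB inter_subset_left ?_).symm
    rintro y ⟨hy1, hy2⟩
    exact test_eq_zero_of_notMem hφ fun h => hy2 ⟨hy1, h⟩
  have h2 := (measurePreserving_add_left volume x).setIntegral_preimage_emb
    (measurableEmbedding_addLeft x) φ (Metric.ball x ε)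
  have h3 : (fun h => x + h) ⁻¹' Metric.ball x ε = Metric.ball (0 : Eucl N) ε := by
    ext h; simp [dist_eq_norm]
  rw [ballAvg, h1, ← h2, h3]

theorem lintegral_sub_ballAvg_sq_le_of_test {φ : Eucl N → ℝ} (hφ : IsTest Ω φ) {ε : ℝ}
    (hε : 0 < ε) : ∫⁻ x, ‖φ x - ballAvg Ω ε φ x‖ₑ ^ 2 ≤
      ENNReal.ofReal ε ^ 2 * ∫⁻ x, ‖gradient φ x‖ₑ ^ 2 := by
  set B := Metric.ball (0 : Eucl N) ε with hB
  set V := volume B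
  have hV0 : V ≠ 0 := (Metric.measure_ball_pos volume _ hε).ne'
  have hVt : V ≠ ⊤ := Metric.isBounded_ball.measure_lt_top.ne
  have hVr : volume.real B ≠ 0 := (ENNReal.toReal_pos hV0 hVt).ne'
  have hBm : MeasurableSet B := Metric.isOpen_ball.measurableSet
  have hc := hφ.smooth.continuous
  have hpt : ∀ x, ‖φ x - ballAvg Ω ε φ x‖ₑ ^ 2 ≤
      V⁻¹ * ∫⁻ h in B, ‖φ (x + h) - φ x‖ₑ ^ 2 := by
    intro x
    have hi1 : Integrable (fun h => φ (x + h)) (volume.restrict B) :=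
      ((hc.integrable_of_hasCompactSupport hφ.compact).comp_add_left x).restrict
    have hi2 : Integrable (fun _ : Eucl N => φ x) (volume.restrict B) :=
      integrableOn_const hVt
    have e1 : φ x - ballAvg Ω ε φ x =
        -((volume.real B)⁻¹ * ∫ h in B, (φ (x + h) - φ x)) := by
      rw [ballAvg_test hφ, ← hB, integral_sub hi1 hi2, setIntegral_const, smul_eq_mul]
      field_simp
      ring
    have e2 : ‖(volume.real B)⁻¹‖ₑ = V⁻¹ := by
      rw [enorm_inv hVr, Measure.real, Real.enorm_of_nonneg ENNReal.toReal_nonneg,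
        ENNReal.ofReal_toReal hVt]
    have e3 : AEMeasurable (fun h => ‖φ (x + h) - φ x‖ₑ) (volume.restrict B) :=
      ((hc.comp (continuous_const.add continuous_id)).sub
        continuous_const).measurable.enorm.aemeasurable
    rw [e1, enorm_neg, enorm_mul, e2, mul_pow]
    calc V⁻¹ ^ 2 * ‖∫ h in B, (φ (x + h) - φ x)‖ₑ ^ 2
        ≤ V⁻¹ ^ 2 * (V * ∫⁻ h in B, ‖φ (x + h) - φ x‖ₑ ^ 2) := by
          gcongr
          refine (pow_le_pow_left' (enorm_integral_le_lintegral_enorm _) 2).trans ?_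
          refine (sq_lintegral_le_mul e3).trans (le_of_eq ?_)
          rw [Measure.restrict_apply_univ]
      _ = V⁻¹ * ∫⁻ h in B, ‖φ (x + h) - φ x‖ₑ ^ 2 := by
          rw [sq, mul_assoc, ← mul_assoc V⁻¹ V, ENNReal.inv_mul_cancel hV0 hVt, one_mul]
  have hm : Measurable (Function.uncurry fun x h : Eucl N => ‖φ (x + h) - φ x‖ₑ ^ 2) := by
    have : Continuous (Function.uncurry fun x h : Eucl N => φ (x + h) - φ x) :=
      (hc.comp (continuous_fst.add continuous_snd)).sub (hc.comp continuous_fst)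
    exact this.measurable.enorm.pow_const 2
  calc ∫⁻ x, ‖φ x - ballAvg Ω ε φ x‖ₑ ^ 2
      ≤ ∫⁻ x, V⁻¹ * ∫⁻ h in B, ‖φ (x + h) - φ x‖ₑ ^ 2 := lintegral_mono hpt
    _ = V⁻¹ * ∫⁻ h in B, ∫⁻ x, ‖φ (x + h) - φ x‖ₑ ^ 2 := by
        rw [lintegral_const_mul' _ _ (ENNReal.inv_ne_top.2 hV0),
          lintegral_lintegral_swap hm.aemeasurable]
    _ ≤ V⁻¹ * ∫⁻ _ in B, ENNReal.ofReal ε ^ 2 * ∫⁻ x, ‖gradient φ x‖ₑ ^ 2 := by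
        gcongr V⁻¹ * ?_
        refine setLIntegral_mono_ae' hBm (ae_of_all _ fun h hh => ?_)
        refine (lintegral_translate_sub_sq_le hφ h).trans ?_
        gcongr
        rw [← ofReal_norm]
        exact ENNReal.ofReal_le_ofReal (mem_ball_zero_iff.1 hh).le
    _ = ENNReal.ofReal ε ^ 2 * ∫⁻ x, ‖gradient φ x‖ₑ ^ 2 := by
        rw [setLIntegral_const, mul_comm _ (volume B), ← mul_assoc,
          ENNReal.inv_mul_cancel hV0 hVt, one_mul]

theorem ballAvg_fn [IsFiniteMeasure (leb Ω)] (ε : ℝ) (u : H10 Ω) (x : Eucl N) :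
    ballAvg Ω ε (fn u) x = (volume.real (Metric.ball (0 : Eucl N) ε))⁻¹ *
      inner ℝ (indicatorConstLp 2 (Metric.isOpen_ball (x := x) (ε := ε)).measurableSet
        (measure_ne_top (leb Ω) _) (1 : ℝ)) (toL2 u) := by
  rw [L2.inner_indicatorConstLp_one]; rfl

theorem lintegral_sub_ballAvg_sq_le [IsFiniteMeasure (leb Ω)] {ε : ℝ} (hε : 0 < ε)
    (u : H10 Ω) : ∫⁻ x, ‖fn u x - ballAvg Ω ε (fn u) x‖ₑ ^ 2 ∂(leb Ω) ≤
      ENNReal.ofReal ε ^ 2 * ‖gradL2 u‖ₑ ^ 2 := by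
  refine H10_induction (P := fun u => ∫⁻ x, ‖fn u x - ballAvg Ω ε (fn u) x‖ₑ ^ 2 ∂(leb Ω) ≤
      ENNReal.ofReal ε ^ 2 * ‖gradL2 u‖ₑ ^ 2) ?_ ?_ u
  · intro w u hw hle
    have hL : Tendsto (fun n => toL2 (w n)) atTop (𝓝 (toL2 u)) :=
      (continuous_toL2.tendsto u).comp hw
    obtain ⟨ns, hns, hae⟩ := (tendstoInMeasure_of_tendsto_Lp hL).exists_seq_tendsto_ae
    have hsm : ∀ v : H10 Ω, Measurable fun x => ‖fn v x - ballAvg Ω ε (fn v) x‖ₑ ^ 2 := fun v =>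
      ((Lp.stronglyMeasurable (toL2 v)).sub (stronglyMeasurable_ballAvg
        (Lp.stronglyMeasurable (toL2 v)))).measurable.enorm.pow_const 2
    calc ∫⁻ x, ‖fn u x - ballAvg Ω ε (fn u) x‖ₑ ^ 2 ∂(leb Ω)
        = ∫⁻ x, liminf (fun i => ‖fn (w (ns i)) x - ballAvg Ω ε (fn (w (ns i))) x‖ₑ ^ 2) atTop
            ∂(leb Ω) := by
          refine lintegral_congr_ae ?_
          filter_upwards [hae] with x hx
          refine (Tendsto.liminf_eq ?_).symm
          refine ((ENNReal.continuous_pow 2).tendsto _).comp (Tendsto.enorm ?_)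
          refine hx.sub ?_
          simp only [ballAvg_fn]
          exact (tendsto_const_nhds.inner (hL.comp hns.tendsto_atTop)).const_mul _
      _ ≤ liminf (fun i => ∫⁻ x, ‖fn (w (ns i)) x - ballAvg Ω ε (fn (w (ns i))) x‖ₑ ^ 2
            ∂(leb Ω)) atTop := lintegral_liminf_le fun i => hsm _
      _ ≤ liminf (fun i => ENNReal.ofReal ε ^ 2 * ‖gradL2 (w (ns i))‖ₑ ^ 2) atTop :=
          liminf_le_liminf (Eventually.of_forall fun i => hle _)
      _ = ENNReal.ofReal ε ^ 2 * ‖gradL2 u‖ₑ ^ 2 := by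
          refine Tendsto.liminf_eq ?_
          refine ENNReal.Tendsto.const_mul ?_ (Or.inr (by finiteness))
          refine ((ENNReal.continuous_pow 2).tendsto _).comp (Tendsto.enorm ?_)
          exact ((continuous_gradL2.tendsto u).comp hw).comp hns.tendsto_atTop
  · intro w φ hφ h1 h2
    rw [enorm_gradL2_sq_of_test hφ h2]
    refine le_trans ?_ (lintegral_sub_ballAvg_sq_le_of_test hφ hε)
    refine le_trans (le_of_eq ?_) (setLIntegral_le_lintegral Ω _)
    refine lintegral_congr_ae ?_
    filter_upwards [h1] with x hx
    have : ballAvg Ω ε (fn w) x = ballAvg Ω ε φ x := by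
      rw [ballAvg, ballAvg, integral_congr_ae (ae_restrict_of_ae h1)]
    rw [hx, this]

/-- **Rellich's theorem**: weak convergence in `H¹₀(Ω)` implies strong convergence in `L²(Ω)`. -/
theorem tendsto_norm_toL2_of_weak [IsFiniteMeasure (leb Ω)] {w : ℕ → H10 Ω} {C : ℝ}
    (hC : ∀ n, ‖w n‖ ≤ C)
    (hw : ∀ v : Lp ℝ 2 (leb Ω), Tendsto (fun n => (inner ℝ v (toL2 (w n)) : ℝ)) atTop (𝓝 0)) :
    Tendsto (fun n => ‖toL2 (w n)‖) atTop (𝓝 0) := by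
  have hC0 : 0 ≤ C := (norm_nonneg _).trans (hC 0)
  have hsm : ∀ ε n, StronglyMeasurable (ballAvg Ω ε (fn (w n))) := fun ε n =>
    stronglyMeasurable_ballAvg (Lp.stronglyMeasurable (toL2 (w n)))
  have havg : ∀ ε : ℝ, Tendsto (fun n => ∫⁻ x, ‖ballAvg Ω ε (fn (w n)) x‖ₑ ^ 2 ∂(leb Ω))
      atTop (𝓝 0) := by
    intro ε
    set A : ℝ := |(volume.real (Metric.ball (0 : Eucl N) ε))⁻¹| *
      ((leb Ω).real univ ^ (1 / (2 : ℝ)) * C)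
    have hbd : ∀ n x, ‖ballAvg Ω ε (fn (w n)) x‖ ≤ A := by
      intro n x
      rw [ballAvg_fn, norm_mul, Real.norm_eq_abs]
      refine mul_le_mul_of_nonneg_left ?_ (abs_nonneg _)
      refine (norm_inner_le_norm _ _).trans ?_
      refine mul_le_mul ?_ ((norm_toL2_le _).trans (hC n)) (norm_nonneg _) (by positivity)
      refine norm_indicatorConstLp_le.trans ?_
      simp only [norm_one, one_mul, ENNReal.toReal_ofNat]
      exact Real.rpow_le_rpow measureReal_nonneg (measureReal_mono (subset_univ _)) (by norm_num)
    have h0 : (0 : ℝ≥0∞) = ∫⁻ _, (0 : ℝ≥0∞) ∂(leb Ω) := by simp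
    rw [h0]
    refine tendsto_lintegral_of_dominated_convergence (fun _ => ENNReal.ofReal A ^ 2)
      (fun n => (hsm ε n).measurable.enorm.pow_const 2) (fun n => ae_of_all _ fun x => ?_) ?_
      (ae_of_all _ fun x => ?_)
    · refine pow_le_pow_left' ?_ 2
      rw [← ofReal_norm]
      exact ENNReal.ofReal_le_ofReal (hbd n x)
    · simp only [lintegral_const]
      finiteness
    · have h1 : Tendsto (fun n => ballAvg Ω ε (fn (w n)) x) atTop (𝓝 0) := by
        simp only [ballAvg_fn]
        simpa using (hw _).const_mul (volume.real (Metric.ball (0 : Eucl N) ε))⁻¹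
      simpa [Function.comp_def] using ((ENNReal.continuous_pow 2).tendsto _).comp h1.enorm
  rw [Metric.tendsto_atTop']
  intro δ hδ
  set ε : ℝ := δ / (2 * (C + 1)) with hεdef
  have hε : 0 < ε := by positivity
  have hεC : ε * C ≤ δ / 2 := by
    rw [hεdef, div_mul_eq_mul_div, div_le_div_iff₀ (by positivity) (by norm_num)]
    nlinarith
  have hev : ∀ᶠ n in atTop, ∫⁻ x, ‖ballAvg Ω ε (fn (w n)) x‖ₑ ^ 2 ∂(leb Ω) <
      ENNReal.ofReal (δ / 2) ^ 2 :=
    (havg ε).eventually_lt_const (by positivity)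
  obtain ⟨n₀, hn₀⟩ := eventually_atTop.1 hev
  refine ⟨n₀, fun n hn => ?_⟩
  have h1 : eLpNorm (fun x => fn (w n) x - ballAvg Ω ε (fn (w n)) x) 2 (leb Ω) ≤
      ENNReal.ofReal (δ / 2) := by
    rw [← ENNReal.pow_le_pow_left_iff two_ne_zero, eLpNorm_two_sq]
    refine (lintegral_sub_ballAvg_sq_le hε (w n)).trans ?_
    rw [← mul_pow]
    gcongr
    rw [← ofReal_norm, ← ENNReal.ofReal_mul hε.le]
    refine ENNReal.ofReal_le_ofReal (le_trans ?_ hεC)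
    exact mul_le_mul_of_nonneg_left ((norm_gradL2_le _).trans (hC n)) hε.le
  have h2 : eLpNorm (ballAvg Ω ε (fn (w n))) 2 (leb Ω) < ENNReal.ofReal (δ / 2) := by
    rw [← ENNReal.pow_lt_pow_left_iff two_ne_zero, eLpNorm_two_sq]
    exact hn₀ n hn.le
  have h3 : ‖toL2 (w n)‖ₑ < ENNReal.ofReal δ := by
    rw [Lp.enorm_def]
    have e : (⇑(toL2 (w n)) : Eucl N → ℝ) =
        (fun x => fn (w n) x - ballAvg Ω ε (fn (w n)) x) + ballAvg Ω ε (fn (w n)) := by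
      ext x; simp [fn]
    rw [e]
    refine (eLpNorm_add_le ((Lp.stronglyMeasurable (toL2 (w n))).sub
      (hsm ε n)).aestronglyMeasurable (hsm ε n).aestronglyMeasurable (by norm_num)).trans_lt ?_
    rw [← add_halves δ, ENNReal.ofReal_add (by positivity) (by positivity)]
    exact ENNReal.add_lt_add_of_le_of_lt (ne_top_of_le_ne_top ENNReal.ofReal_ne_top h1) h1 h2
  rw [dist_zero_right, norm_norm]
  rw [← ofReal_norm] at h3
  exact (ENNReal.ofReal_lt_ofReal_iff hδ).1 h3

end OptPot

namespace OptPot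

theorem tendsto_dual_of_weak {H ι : Type*} [NormedAddCommGroup H] [InnerProductSpace ℝ H]
    [CompleteSpace H] {l : Filter ι} {u : ι → H} {x : H}
    (h : ∀ v : H, Tendsto (fun n => (inner ℝ v (u n) : ℝ)) l (𝓝 (inner ℝ v x)))
    (F : StrongDual ℝ H) : Tendsto (fun n => F (u n)) l (𝓝 (F x)) := by
  obtain ⟨y, rfl⟩ := (InnerProductSpace.toDual ℝ H).surjective F
  simpa only [InnerProductSpace.toDual_apply_apply] using h y

variable {N : ℕ} {Ω : Set (Eucl N)}

/-- The embedding of `H¹₀(Ω)` into `L²(Ω)`. -/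
noncomputable def toL2CLM (Ω : Set (Eucl N)) : H10 Ω →L[ℝ] Lp ℝ 2 (leb Ω) where
  toFun := toL2
  map_add' _ _ := rfl
  map_smul' _ _ := rfl
  cont := continuous_toL2

/-- The weak gradient, as a map from `H¹₀(Ω)` into `L²(Ω)^N`. -/
noncomputable def gradL2CLM (Ω : Set (Eucl N)) : H10 Ω →L[ℝ] Lp (Eucl N) 2 (leb Ω) where
  toFun := gradL2
  map_add' _ _ := rfl
  map_smul' _ _ := rfl
  cont := continuous_gradL2

theorem toL2_injective (hΩ : IsOpen Ω) {u v : H10 Ω} (h : toL2 u = toL2 v) : u = v :=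
  fn_injective hΩ (by change ⇑(toL2 u) =ᵐ[leb Ω] ⇑(toL2 v); rw [h])

theorem tendsto_inner_toL2 {ι : Type*} {l : Filter ι} {u : ι → H10 Ω} {x : H10 Ω}
    (h : ∀ v : H10 Ω, Tendsto (fun n => (inner ℝ v (u n) : ℝ)) l (𝓝 (inner ℝ v x)))
    (z : Lp ℝ 2 (leb Ω)) :
    Tendsto (fun n => (inner ℝ z (toL2 (u n)) : ℝ)) l (𝓝 (inner ℝ z (toL2 x))) :=
  tendsto_dual_of_weak h ((InnerProductSpace.toDual ℝ _ z).comp (toL2CLM Ω))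

theorem tendsto_inner_gradL2 {ι : Type*} {l : Filter ι} {u : ι → H10 Ω} {x : H10 Ω}
    (h : ∀ v : H10 Ω, Tendsto (fun n => (inner ℝ v (u n) : ℝ)) l (𝓝 (inner ℝ v x)))
    (z : Lp (Eucl N) 2 (leb Ω)) :
    Tendsto (fun n => (inner ℝ z (gradL2 (u n)) : ℝ)) l (𝓝 (inner ℝ z (gradL2 x))) :=
  tendsto_dual_of_weak h ((InnerProductSpace.toDual ℝ _ z).comp (gradL2CLM Ω))

/-- A bounded family in `H¹₀(Ω)` that converges weakly in `L²(Ω)` has its limit in `H¹₀(Ω)`, and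
converges weakly in `H¹₀(Ω)`. -/
theorem exists_weak_limit_of_toL2 (U : Ultrafilter ℕ) {w : ℕ → H10 Ω} {C : ℝ}
    (hC : ∀ n, ‖w n‖ ≤ C) {g : Lp ℝ 2 (leb Ω)}
    (hg : ∀ z : Lp ℝ 2 (leb Ω), Tendsto (fun n => (inner ℝ z (toL2 (w n)) : ℝ)) U
      (𝓝 (inner ℝ z g))) :
    ∃ x : H10 Ω, toL2 x = g ∧ ‖x‖ ≤ C ∧
      ∀ F : Hminus1 Ω, Tendsto (fun n => F (w n)) U (𝓝 (F x)) := by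
  obtain ⟨x, hx⟩ := exists_ultrafilter_weak_limit U hC
  refine ⟨x, ?_, norm_weak_limit_le hC hx, tendsto_dual_of_weak hx⟩
  exact ext_inner_left ℝ fun z => tendsto_nhds_unique (tendsto_inner_toL2 hx z) (hg z)

/-- The bounded approximation `k sin (s / k)` of `s`. -/
noncomputable def sinTrunc (k s : ℝ) : ℝ := k * Real.sin (s / k)

theorem abs_sinTrunc_sub_le {k : ℝ} (hk : 0 < k) (s t : ℝ) :
    |sinTrunc k s - sinTrunc k t| ≤ |s - t| := by
  rw [sinTrunc, sinTrunc, ← mul_sub, abs_mul, abs_of_pos hk]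
  calc k * |Real.sin (s / k) - Real.sin (t / k)| ≤ k * |s / k - t / k| := by
        exact mul_le_mul_of_nonneg_left (Real.abs_sin_sub_sin_le _ _) hk.le
    _ = |s - t| := by rw [← sub_div, abs_div, abs_of_pos hk]; field_simp

theorem sinTrunc_zero (k : ℝ) : sinTrunc k 0 = 0 := by simp [sinTrunc]

theorem abs_sinTrunc_le_abs {k : ℝ} (hk : 0 < k) (s : ℝ) : |sinTrunc k s| ≤ |s| := by
  simpa [sinTrunc_zero] using abs_sinTrunc_sub_le hk s 0

theorem abs_sinTrunc_le {k : ℝ} (hk : 0 < k) (s : ℝ) : |sinTrunc k s| ≤ k := by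
  rw [sinTrunc, abs_mul, abs_of_pos hk]
  exact mul_le_of_le_one_right hk.le (Real.abs_sin_le_one _)

theorem continuous_sinTrunc (k : ℝ) : Continuous (sinTrunc k) :=
  continuous_const.mul (Real.continuous_sin.comp (continuous_id.div_const k))

theorem tendsto_sinTrunc (s : ℝ) :
    Tendsto (fun n : ℕ => sinTrunc (n + 1) s) atTop (𝓝 s) := by
  have h1 : HasDerivAt (fun t : ℝ => Real.sin (t * s)) s 0 := by
    simpa using (((hasDerivAt_id (0 : ℝ)).mul_const s).sin)
  have h2 := h1.tendsto_slope_zero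
  have h3 : Tendsto (fun n : ℕ => ((n : ℝ) + 1)⁻¹) atTop (𝓝[≠] 0) := by
    refine tendsto_nhdsWithin_iff.2 ⟨by simpa using tendsto_one_div_add_atTop_nhds_zero_nat (𝕜 := ℝ),
      Eventually.of_forall fun n => ?_⟩
    simp only [mem_compl_iff, mem_singleton_iff, inv_eq_zero]
    positivity
  refine (h2.comp h3).congr fun n => ?_
  simp [sinTrunc, div_eq_inv_mul]

theorem IsTest.sinTrunc {φ : Eucl N → ℝ} (hφ : IsTest Ω φ) (k : ℝ) :
    IsTest Ω (fun x => sinTrunc k (φ x)) where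
  smooth := contDiff_const.mul (Real.contDiff_sin.comp (hφ.smooth.div_const k))
  compact := hφ.compact.comp_left (sinTrunc_zero k)
  supp := (closure_mono (Function.support_comp_subset (sinTrunc_zero k) φ)).trans hφ.supp

theorem norm_gradient_sinTrunc_le {φ : Eucl N → ℝ} (hφ : IsTest Ω φ) {k : ℝ} (hk : 0 < k)
    (x : Eucl N) : ‖gradient (fun x => sinTrunc k (φ x)) x‖ ≤ ‖gradient φ x‖ := by
  have h1 : HasFDerivAt φ (fderiv ℝ φ x) x := (hφ.smooth.differentiable (by simp) x).hasFDerivAt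
  have h2 : HasDerivAt (OptPot.sinTrunc k) (Real.cos (φ x / k)) (φ x) := by
    have := (((hasDerivAt_id (φ x)).div_const k).sin).const_mul k
    refine this.congr_deriv ?_
    simp only [id]
    field_simp
  have h3 : fderiv ℝ (fun x => OptPot.sinTrunc k (φ x)) x =
      Real.cos (φ x / k) • fderiv ℝ φ x := (h2.comp_hasFDerivAt x h1).fderiv
  rw [gradient, gradient, LinearIsometryEquiv.norm_map, LinearIsometryEquiv.norm_map, h3, norm_smul]
  exact mul_le_of_le_one_left (norm_nonneg _) (Real.abs_cos_le_one _)

theorem exists_sinTrunc_of_test {w : H10 Ω} {φ : Eucl N → ℝ} (hφ : IsTest Ω φ)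
    (h1 : fn w =ᵐ[leb Ω] φ) (h2 : grad w =ᵐ[leb Ω] gradient φ) {k : ℝ} (hk : 0 < k) :
    ∃ w' : H10 Ω, fn w' =ᵐ[leb Ω] (fun x => sinTrunc k (fn w x)) ∧ ‖w'‖ ≤ ‖w‖ := by
  obtain ⟨w', h3, h4⟩ := test_mem (hφ.sinTrunc k)
  refine ⟨w', ?_, ?_⟩
  · filter_upwards [h1, h3] with x h1 h3
    rw [h1, h3]
  · have e1 : ‖toL2 w'‖ ≤ ‖toL2 w‖ := by
      refine Lp.norm_le_norm_of_ae_le ?_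
      filter_upwards [h1, h3] with x h1 h3
      change ‖fn w' x‖ ≤ ‖fn w x‖
      rw [h1, h3]
      exact abs_sinTrunc_le_abs hk _
    have e2 : ‖gradL2 w'‖ ≤ ‖gradL2 w‖ := by
      refine Lp.norm_le_norm_of_ae_le ?_
      filter_upwards [h2, h4] with x h2 h4
      change ‖grad w' x‖ ≤ ‖grad w x‖
      rw [h2, h4]
      exact norm_gradient_sinTrunc_le hφ hk x
    refine abs_le_of_sq_le_sq' ?_ (norm_nonneg w) |>.2
    rw [norm_sq_eq, norm_sq_eq]
    gcongr

theorem exists_sinTrunc (v : H10 Ω) {k : ℝ} (hk : 0 < k) :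
    ∃ w : H10 Ω, fn w =ᵐ[leb Ω] (fun x => sinTrunc k (fn v x)) ∧ ‖w‖ ≤ ‖v‖ + 1 := by
  obtain ⟨p, hp, hlim⟩ := mem_closure_iff_seq_limit.1 v.2
  have hv1 : ‖(v : L2Pair Ω)‖ < ‖v‖ + 1 := by
    rw [Submodule.coe_norm]; linarith
  obtain ⟨n₀, hn₀⟩ := eventually_atTop.1 (hlim.norm.eventually_lt_const hv1)
  set q : ℕ → H10 Ω := fun n => ⟨p (n + n₀), subset_closure (hp _)⟩
  have hqv : Tendsto q atTop (𝓝 v) :=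
    tendsto_subtype_rng.2 (hlim.comp (tendsto_add_atTop_nat n₀))
  have hex : ∀ n, ∃ w : H10 Ω, fn w =ᵐ[leb Ω] (fun x => sinTrunc k (fn (q n) x)) ∧
      ‖w‖ ≤ ‖v‖ + 1 := by
    intro n
    obtain ⟨φ, hφ, h1, h2⟩ := hp (n + n₀)
    obtain ⟨w, h3, h4⟩ := exists_sinTrunc_of_test (w := q n) hφ h1 h2 hk
    exact ⟨w, h3, h4.trans (hn₀ _ (Nat.le_add_left _ _)).le⟩
  choose w hw1 hw2 using hex
  have hmem : MemLp (fun x => sinTrunc k (fn v x)) 2 (leb Ω) :=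
    (Lp.memLp (toL2 v)).mono ((continuous_sinTrunc k).comp_aestronglyMeasurable
      (Lp.aestronglyMeasurable (toL2 v))) (ae_of_all _ fun x => abs_sinTrunc_le_abs hk _)
  have hconv : Tendsto (fun n => toL2 (w n)) atTop (𝓝 (hmem.toLp _)) := by
    rw [tendsto_iff_norm_sub_tendsto_zero]
    have h0 : Tendsto (fun n => ‖toL2 (q n) - toL2 v‖) atTop (𝓝 0) :=
      tendsto_iff_norm_sub_tendsto_zero.1 ((continuous_toL2.tendsto v).comp hqv)
    refine squeeze_zero (fun n => norm_nonneg _) (fun n => ?_) h0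
    refine Lp.norm_le_norm_of_ae_le ?_
    filter_upwards [hw1 n, hmem.coeFn_toLp, Lp.coeFn_sub (toL2 (w n)) (hmem.toLp _),
      Lp.coeFn_sub (toL2 (q n)) (toL2 v)] with x h1 h2 h3 h4
    rw [h3, h4, Pi.sub_apply, Pi.sub_apply, h2]
    change ‖fn (w n) x - _‖ ≤ ‖fn (q n) x - fn v x‖
    rw [h1]
    exact abs_sinTrunc_sub_le hk _ _
  obtain ⟨x, hx1, hx2, -⟩ := exists_weak_limit_of_toL2 (hyperfilter ℕ) hw2
    (fun z => ((tendsto_const_nhds.inner hconv).mono_left Nat.hyperfilter_le_atTop))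
  refine ⟨x, ?_, hx2⟩
  rw [fn]
  change ⇑(toL2 x) =ᵐ[leb Ω] _
  rw [hx1]
  exact hmem.coeFn_toLp

/-- Bounded functions are dense in `H¹₀(Ω)`, for the weak topology and the dominated pointwise
convergence. -/
theorem exists_bounded_approx (hΩ : IsOpen Ω) (v : H10 Ω) :
    ∃ w : ℕ → H10 Ω, (∀ n, ∃ B : ℝ, ∀ᵐ x ∂(leb Ω), |fn (w n) x| ≤ B) ∧
      (∀ n, ∀ᵐ x ∂(leb Ω), |fn (w n) x| ≤ |fn v x|) ∧
      (∀ᵐ x ∂(leb Ω), Tendsto (fun n => fn (w n) x) atTop (𝓝 (fn v x))) ∧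
      ∀ F : Hminus1 Ω, Tendsto (fun n => F (w n)) (hyperfilter ℕ) (𝓝 (F v)) := by
  have hpos : ∀ n : ℕ, (0 : ℝ) < n + 1 := fun n => by positivity
  choose w hw1 hw2 using fun n : ℕ => exists_sinTrunc v (hpos n)
  have hdom : ∀ n, ∀ᵐ x ∂(leb Ω), |fn (w n) x| ≤ |fn v x| := fun n => by
    filter_upwards [hw1 n] with x hx
    rw [hx]; exact abs_sinTrunc_le_abs (hpos n) _
  have hlim : ∀ᵐ x ∂(leb Ω), Tendsto (fun n => fn (w n) x) atTop (𝓝 (fn v x)) := by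
    filter_upwards [ae_all_iff.2 hw1] with x hx
    simp only [hx]
    exact tendsto_sinTrunc _
  refine ⟨w, fun n => ⟨n + 1, ?_⟩, hdom, hlim, ?_⟩
  · filter_upwards [hw1 n] with x hx
    rw [hx]; exact abs_sinTrunc_le (hpos n) _
  · obtain ⟨x, hx1, -, hx2⟩ := exists_weak_limit_of_toL2 (hyperfilter ℕ) (g := toL2 v) hw2
      (fun z => by
        refine Tendsto.mono_left ?_ Nat.hyperfilter_le_atTop
        simp only [L2.inner_def]
        refine tendsto_integral_of_dominated_convergence (fun x => ‖z x‖ * ‖toL2 v x‖)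
          (fun n => (Lp.aestronglyMeasurable z).inner (Lp.aestronglyMeasurable (toL2 (w n))))
          ((Lp.memLp z).norm.integrable_mul (Lp.memLp (toL2 v)).norm) (fun n => ?_) ?_
        · filter_upwards [hdom n] with x hx
          exact (norm_inner_le_norm _ _).trans (mul_le_mul_of_nonneg_left hx (norm_nonneg _))
        · filter_upwards [hlim] with x hx
          exact tendsto_const_nhds.inner hx)
    exact toL2_injective hΩ hx1 ▸ hx2

end OptPot

namespace OptPot

section WeakL1

variable {α : Type*} [MeasurableSpace α] {μ : Measure α}

theorem convex_nonneg_Lp : Convex ℝ {g : Lp ℝ 2 μ | 0 ≤ g} := by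
  intro f hf g hg a b ha hb _
  rw [mem_ofPred_eq, ← Lp.coeFn_nonneg] at *
  filter_upwards [hf, hg, Lp.coeFn_add (a • f) (b • g), Lp.coeFn_smul a f, Lp.coeFn_smul b g]
    with x h1 h2 h3 h4 h5
  rw [h3, Pi.add_apply, h4, h5]
  simp only [Pi.zero_apply, Pi.smul_apply, smul_eq_mul] at *
  positivity

theorem nonneg_of_weak {ι : Type*} {l : Filter ι} [l.NeBot] {f : ι → Lp ℝ 2 μ} {g : Lp ℝ 2 μ}
    (hf : ∀ n, 0 ≤ f n)
    (h : ∀ v : Lp ℝ 2 μ, Tendsto (fun n => (inner ℝ v (f n) : ℝ)) l (𝓝 (inner ℝ v g))) : 0 ≤ g :=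
  weak_limit_mem (K := {g : Lp ℝ 2 μ | 0 ≤ g}) convex_nonneg_Lp isClosed_Ici
    (Eventually.of_forall hf) h

variable [IsFiniteMeasure μ]

theorem memLp_min_natCast {m : α → ℝ} (hm : AEStronglyMeasurable m μ) (h0 : ∀ᵐ x ∂μ, 0 ≤ m x)
    (k : ℕ) : MemLp (fun x => min (m x) k) 2 μ := by
  refine MemLp.of_bound (hm.inf aestronglyMeasurable_const) (k : ℝ) ?_
  filter_upwards [h0] with x hx
  rw [Real.norm_of_nonneg (le_min hx (Nat.cast_nonneg k))]
  exact min_le_right _ _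

/-- The truncation `min m k` of a nonnegative function, as an element of `L²`. -/
noncomputable def truncL2 {m : α → ℝ} (hm : AEStronglyMeasurable m μ) (h0 : ∀ᵐ x ∂μ, 0 ≤ m x)
    (k : ℕ) : Lp ℝ 2 μ :=
  (memLp_min_natCast hm h0 k).toLp _

theorem coeFn_truncL2 {m : α → ℝ} (hm : AEStronglyMeasurable m μ) (h0 : ∀ᵐ x ∂μ, 0 ≤ m x)
    (k : ℕ) : truncL2 hm h0 k =ᵐ[μ] fun x => min (m x) k :=
  MemLp.coeFn_toLp _

theorem norm_truncL2_le {m : α → ℝ} (hm : AEStronglyMeasurable m μ) (h0 : ∀ᵐ x ∂μ, 0 ≤ m x)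
    (k : ℕ) : ‖truncL2 hm h0 k‖ ≤ μ.real univ ^ (2 : ℝ≥0∞).toReal⁻¹ * k := by
  have := Lp.norm_le_of_ae_bound (f := truncL2 hm h0 k) (C := (k : ℝ)) (Nat.cast_nonneg k) (by
    filter_upwards [h0, coeFn_truncL2 hm h0 k] with x hx hx2
    rw [hx2, Real.norm_of_nonneg (le_min hx (Nat.cast_nonneg k))]
    exact min_le_right _ _)
  simpa only [Measure.real, measureUnivNNReal, ENNReal.coe_toNNReal_eq_toReal] using this

/-- The data of a weak `L¹` limit `m` of the sequence `m_n ≥ 0`, along the ultrafilter `U`: the weak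
`L²` limits `M k` of the truncations `min m_n k` increase to `m`. -/
structure IsTruncLimit (U : Ultrafilter ℕ) {mn : ℕ → α → ℝ}
    (hm : ∀ n, AEStronglyMeasurable (mn n) μ) (h0 : ∀ n, ∀ᵐ x ∂μ, 0 ≤ mn n x)
    (M : ℕ → Lp ℝ 2 μ) (m : α → ℝ) : Prop where
  integrable : Integrable m μ
  nonneg : ∀ᵐ x ∂μ, 0 ≤ m x
  weak : ∀ (k : ℕ) (v : Lp ℝ 2 μ),
    Tendsto (fun n => (inner ℝ v (truncL2 (hm n) (h0 n) k) : ℝ)) U (𝓝 (inner ℝ v (M k)))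
  dominated : ∀ k, ∀ᵐ x ∂μ, |M k x| ≤ m x
  tendsto : ∀ᵐ x ∂μ, Tendsto (fun k => M k x) atTop (𝓝 (m x))

theorem exists_truncLimit (U : Ultrafilter ℕ) {mn : ℕ → α → ℝ} (hi : ∀ n, Integrable (mn n) μ)
    (h0 : ∀ n, ∀ᵐ x ∂μ, 0 ≤ mn n x) {C : ℝ} (hC : ∀ n, ∫ x, mn n x ∂μ ≤ C) :
    ∃ M m, IsTruncLimit U (fun n => (hi n).aestronglyMeasurable) h0 M m := by
  have hm := fun n => (hi n).aestronglyMeasurable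
  choose M hM using fun k : ℕ => exists_ultrafilter_weak_limit U
    (fun n => norm_truncL2_le (hm n) (h0 n) k)
  have hM0 : ∀ k, 0 ≤ M k := fun k => by
    refine nonneg_of_weak (fun n => ?_) (hM k)
    rw [← Lp.coeFn_nonneg]
    filter_upwards [h0 n, coeFn_truncL2 (hm n) (h0 n) k] with x h1 h2
    rw [h2]
    exact le_min h1 (Nat.cast_nonneg k)
  have hMmono : ∀ k, M k ≤ M (k + 1) := fun k => by
    rw [← sub_nonneg]
    refine nonneg_of_weak (l := (U : Filter ℕ)) (f := fun n => truncL2 (hm n) (h0 n) (k + 1) -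
      truncL2 (hm n) (h0 n) k) (fun n => ?_) (fun v => ?_)
    · rw [sub_nonneg, ← Lp.coeFn_le]
      filter_upwards [coeFn_truncL2 (hm n) (h0 n) k, coeFn_truncL2 (hm n) (h0 n) (k + 1)]
        with x h1 h2
      rw [h1, h2]
      exact min_le_min_left _ (by simp)
    · simp only [inner_sub_right]
      exact (hM (k + 1) v).sub (hM k v)
  have hMi : ∀ k, Integrable (M k) μ := fun k => (Lp.memLp (M k)).integrable (by norm_num)
  have hMC : ∀ k, ∫ x, M k x ∂μ ≤ C := fun k => by
    have h1 := hM k (indicatorConstLp 2 MeasurableSet.univ (measure_ne_top μ _) (1 : ℝ))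
    simp only [L2.inner_indicatorConstLp_one, Measure.restrict_univ] at h1
    refine le_of_tendsto h1 (Eventually.of_forall fun n => le_trans ?_ (hC n))
    refine integral_mono_ae ((Lp.memLp _).integrable (by norm_num)) (hi n) ?_
    filter_upwards [coeFn_truncL2 (hm n) (h0 n) k] with x hx
    rw [hx]
    exact min_le_left _ _
  have hae0 : ∀ᵐ x ∂μ, ∀ k, 0 ≤ M k x := ae_all_iff.2 fun k => by
    filter_upwards [Lp.coeFn_nonneg (M k) |>.2 (hM0 k)] with x hx using hx
  have haem : ∀ᵐ x ∂μ, Monotone fun k => M k x := by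
    filter_upwards [ae_all_iff.2 fun k => (Lp.coeFn_le (M k) (M (k + 1))).2 (hMmono k)] with x hx
    exact monotone_nat_of_le_succ hx
  set F : α → ℝ≥0∞ := fun x => ⨆ k, ENNReal.ofReal (M k x)
  have hFm : ∀ k, Measurable fun x => ENNReal.ofReal (M k x) := fun k =>
    (Lp.stronglyMeasurable (M k)).measurable.ennreal_ofReal
  have hF : ∫⁻ x, F x ∂μ ≤ ENNReal.ofReal C := by
    rw [lintegral_iSup' (fun k => (hFm k).aemeasurable) (by
      filter_upwards [haem] with x hx k l hkl using ENNReal.ofReal_le_ofReal (hx hkl))]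
    refine iSup_le fun k => ?_
    rw [← ofReal_integral_eq_lintegral_ofReal (hMi k) ((Lp.coeFn_nonneg (M k)).2 (hM0 k))]
    exact ENNReal.ofReal_le_ofReal (hMC k)
  have hFne : ∫⁻ x, F x ∂μ ≠ ⊤ := ne_top_of_le_ne_top ENNReal.ofReal_ne_top hF
  have hFmeas : Measurable F := Measurable.iSup hFm
  have hFfin : ∀ᵐ x ∂μ, F x < ⊤ := ae_lt_top hFmeas hFne
  refine ⟨M, fun x => (F x).toReal, integrable_toReal_of_lintegral_ne_top hFmeas.aemeasurable hFne,
    ae_of_all _ fun x => ENNReal.toReal_nonneg, hM, fun k => ?_, ?_⟩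
  · filter_upwards [hae0, hFfin] with x h1 h2
    rw [abs_of_nonneg (h1 k), ← ENNReal.ofReal_le_iff_le_toReal h2.ne]
    exact le_iSup (fun k => ENNReal.ofReal (M k x)) k
  · filter_upwards [hae0, haem, hFfin] with x h1 h2 h3
    have h4 : Tendsto (fun k => ENNReal.ofReal (M k x)) atTop (𝓝 (F x)) :=
      tendsto_atTop_iSup fun k l hkl => ENNReal.ofReal_le_ofReal (h2 hkl)
    refine ((ENNReal.tendsto_toReal h3.ne).comp h4).congr fun k => ?_
    exact ENNReal.toReal_ofReal (h1 k)

/-- Weak-strong convergence: the product of a weakly convergent equiintegrable sequence and of a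
bounded sequence that converges almost everywhere. -/
theorem IsTruncLimit.tendsto_integral_mul {U : Ultrafilter ℕ} (hU : (U : Filter ℕ) ≤ atTop)
    {mn : ℕ → α → ℝ} {hm : ∀ n, AEStronglyMeasurable (mn n) μ}
    {h0 : ∀ n, ∀ᵐ x ∂μ, 0 ≤ mn n x} {M : ℕ → Lp ℝ 2 μ} {m : α → ℝ}
    (h : IsTruncLimit U hm h0 M m) (hi : ∀ n, Integrable (mn n) μ)
    (htail : ∀ δ : ℝ, 0 < δ → ∃ k₀ : ℕ, ∀ k ≥ k₀, ∀ n, ∫ x, (mn n x - min (mn n x) k) ∂μ ≤ δ)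
    {gn : ℕ → α → ℝ} {g : α → ℝ} {G : ℝ} (hgm : ∀ n, AEStronglyMeasurable (gn n) μ)
    (hgb : ∀ n, ∀ᵐ x ∂μ, |gn n x| ≤ G)
    (hg : ∀ᵐ x ∂μ, Tendsto (fun n => gn n x) atTop (𝓝 (g x))) :
    Tendsto (fun n => ∫ x, mn n x * gn n x ∂μ) U (𝓝 (∫ x, m x * g x ∂μ)) := by
  have hgmeas : AEStronglyMeasurable g μ := aestronglyMeasurable_of_tendsto_ae atTop hgm hg
  have hgG : ∀ᵐ x ∂μ, |g x| ≤ G := by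
    filter_upwards [ae_all_iff.2 hgb, hg] with x h1 h2
    exact le_of_tendsto h2.abs (Eventually.of_forall h1)
  have hg2 : MemLp g 2 μ := MemLp.of_bound hgmeas G hgG
  have hTi : ∀ (k n : ℕ), Integrable (fun x => min (mn n x) (k : ℝ)) μ := fun k n =>
    (memLp_min_natCast (hm n) (h0 n) k).integrable (by norm_num)
  have hA : Tendsto (fun k => ∫ x, M k x * g x ∂μ) atTop (𝓝 (∫ x, m x * g x ∂μ)) := by
    refine tendsto_integral_of_dominated_convergence (fun x => m x * G)
      (fun k => (Lp.aestronglyMeasurable (M k)).mul hgmeas) (h.integrable.mul_const G)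
      (fun k => ?_) ?_
    · filter_upwards [h.dominated k, hgG] with x h1 h2
      rw [norm_mul]
      exact mul_le_mul h1 h2 (abs_nonneg _) ((abs_nonneg _).trans h1)
    · filter_upwards [h.tendsto] with x hx using hx.mul_const _
  have hB : ∀ k : ℕ, Tendsto (fun n => ∫ x, min (mn n x) (k : ℝ) * gn n x ∂μ) U
      (𝓝 (∫ x, M k x * g x ∂μ)) := by
    intro k
    have h1 : Tendsto (fun n => ∫ x, min (mn n x) (k : ℝ) * g x ∂μ) U
        (𝓝 (∫ x, M k x * g x ∂μ)) := by
      have h2 := h.weak k (hg2.toLp g)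
      simp only [L2.inner_def] at h2
      refine (h2.congr fun n => integral_congr_ae ?_).trans_eq (congrArg 𝓝 (integral_congr_ae ?_))
      · filter_upwards [hg2.coeFn_toLp, coeFn_truncL2 (hm n) (h0 n) k] with x h3 h4
        rw [h3, h4]; rfl
      · filter_upwards [hg2.coeFn_toLp] with x h3
        rw [h3]; rfl
    have h2 : Tendsto (fun n => ∫ x, min (mn n x) (k : ℝ) * (gn n x - g x) ∂μ) atTop (𝓝 0) := by
      have e : (0 : ℝ) = ∫ _, (0 : ℝ) ∂μ := by simp
      rw [e]
      refine tendsto_integral_of_dominated_convergence (fun _ => k * (G + G))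
        (fun n => (hTi k n).aestronglyMeasurable.mul ((hgm n).sub hgmeas))
        (integrable_const _) (fun n => ?_) ?_
      · filter_upwards [h0 n, hgb n, hgG] with x h3 h4 h5
        rw [norm_mul, Real.norm_of_nonneg (le_min h3 (Nat.cast_nonneg k))]
        refine mul_le_mul (min_le_right _ _) ?_ (norm_nonneg _) (Nat.cast_nonneg k)
        exact (norm_sub_le _ _).trans (add_le_add h4 h5)
      · filter_upwards [hg, ae_all_iff.2 h0] with x h3 h4
        refine squeeze_zero_norm (a := fun n => k * |gn n x - g x|) (fun n => ?_) ?_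
        · rw [norm_mul, Real.norm_of_nonneg (le_min (h4 n) (Nat.cast_nonneg k))]
          exact mul_le_mul_of_nonneg_right (min_le_right _ _) (abs_nonneg _)
        · have : Tendsto (fun n => gn n x - g x) atTop (𝓝 0) := by
            simpa using h3.sub_const (g x)
          simpa using this.abs.const_mul (k : ℝ)
    refine (h1.add (h2.mono_left hU)).congr' (Eventually.of_forall fun n => ?_) |>.trans_eq
      (by rw [add_zero])
    have i1 : Integrable (fun x => min (mn n x) (k : ℝ) * g x) μ := (hTi k n).mul_bdd (c := G) hgmeas hgG
    have i2 : Integrable (fun x => min (mn n x) (k : ℝ) * (gn n x - g x)) μ := by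
      refine (hTi k n).mul_bdd (c := G + G) ((hgm n).sub hgmeas) ?_
      filter_upwards [hgb n, hgG] with x h4 h5
      exact (norm_sub_le _ _).trans (add_le_add h4 h5)
    rw [← integral_add i1 i2]
    refine integral_congr_ae (ae_of_all _ fun x => ?_)
    ring
  have hC : ∀ (k n : ℕ), |∫ x, mn n x * gn n x ∂μ - ∫ x, min (mn n x) (k : ℝ) * gn n x ∂μ| ≤
      G * ∫ x, (mn n x - min (mn n x) k) ∂μ := by
    intro k n
    rw [← integral_sub ((hi n).mul_bdd (c := G) (hgm n) (hgb n)) ((hTi k n).mul_bdd (c := G) (hgm n) (hgb n)),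
      ← integral_const_mul]
    rw [← Real.norm_eq_abs]
    refine norm_integral_le_of_norm_le (((hi n).sub (hTi k n)).const_mul G) ?_
    filter_upwards [hgb n] with x hx
    rw [← sub_mul, norm_mul, mul_comm,
      Real.norm_of_nonneg (sub_nonneg.2 (min_le_left (mn n x) (k : ℝ)))]
    exact mul_le_mul_of_nonneg_right hx (sub_nonneg.2 (min_le_left _ _))
  rw [Metric.tendsto_nhds]
  intro ε hε
  obtain ⟨k₀, hk₀⟩ := htail (ε / (4 * (|G| + 1))) (by positivity)
  obtain ⟨k, hk1, hk2⟩ :=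
    ((eventually_ge_atTop k₀).and (Metric.tendsto_nhds.1 hA (ε / 4) (by positivity))).exists
  filter_upwards [Metric.tendsto_nhds.1 (hB k) (ε / 4) (by positivity)] with n hn
  rw [Real.dist_eq] at *
  have h1 : |∫ x, mn n x * gn n x ∂μ - ∫ x, min (mn n x) (k : ℝ) * gn n x ∂μ| ≤ ε / 4 := by
    refine (hC k n).trans ?_
    have hI : 0 ≤ ∫ x, (mn n x - min (mn n x) k) ∂μ :=
      integral_nonneg fun x => sub_nonneg.2 (min_le_left _ _)
    calc G * ∫ x, (mn n x - min (mn n x) k) ∂μ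
        ≤ (|G| + 1) * (ε / (4 * (|G| + 1))) :=
          mul_le_mul (by linarith [le_abs_self G]) (hk₀ k hk1 n) hI (by positivity)
      _ = ε / 4 := by field_simp
  rw [abs_lt] at hn hk2 ⊢
  rw [abs_le] at h1
  constructor <;> linarith [h1.1, h1.2, hn.1, hn.2, hk2.1, hk2.2]

end WeakL1

section Superlinear

variable {ψ : ℝ → ℝ≥0∞}

/-- A superlinear convex function is nondecreasing on a neighborhood of `∞`. -/
theorem exists_le_of_superlinear (hconv : ConvexOn ℝ≥0 univ ψ)
    (hsuper : Tendsto (fun s : ℝ => ψ s / ENNReal.ofReal s) atTop (𝓝 ⊤)) :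
    ∃ k₀ : ℕ, ∀ k s : ℝ, k₀ ≤ k → k ≤ s → ψ k ≤ ψ s := by
  by_cases hdom : ∃ t, ψ t < ⊤
  swap
  · simp only [not_exists, not_lt, top_le_iff] at hdom
    exact ⟨0, fun k s _ _ => by rw [hdom, hdom]⟩
  obtain ⟨t, ht⟩ := hdom
  obtain ⟨s₀, hs₀⟩ := eventually_atTop.1 (hsuper.eventually_const_lt ht)
  obtain ⟨k₀, hk₀⟩ := exists_nat_ge (max (max s₀ 1) (t + 1))
  have hbig : ∀ s : ℝ, k₀ ≤ s → ψ t ≤ ψ s := by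
    intro s hs
    have h1 := hs₀ s (((le_max_left _ _).trans (le_max_left _ _)).trans (hk₀.trans hs))
    have h2 : (1 : ℝ) ≤ s := ((le_max_right _ _).trans (le_max_left _ _)).trans (hk₀.trans hs)
    refine h1.le.trans (ENNReal.div_le_of_le_mul ?_)
    exact le_mul_of_one_le_right' (by simpa using h2)
  refine ⟨k₀, fun k s hk hks => ?_⟩
  have htk : t < k := by linarith [(le_max_right _ _).trans (hk₀.trans hk)]
  have hts : 0 < s - t := by linarith
  obtain ⟨a, ha⟩ : ∃ a : ℝ≥0, (a : ℝ) = (s - k) / (s - t) :=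
    ⟨⟨_, div_nonneg (by linarith) hts.le⟩, rfl⟩
  obtain ⟨b, hb⟩ : ∃ b : ℝ≥0, (b : ℝ) = (k - t) / (s - t) :=
    ⟨⟨_, div_nonneg (by linarith) hts.le⟩, rfl⟩
  have hab : a + b = 1 := by
    ext
    rw [NNReal.coe_add, ha, hb, NNReal.coe_one]
    field_simp
    ring
  have hk' : a • t + b • s = k := by
    rw [NNReal.smul_def, NNReal.smul_def, ha, hb, smul_eq_mul, smul_eq_mul]
    field_simp
    ring
  have h := hconv.2 (mem_univ t) (mem_univ s) zero_le zero_le hab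
  rw [hk'] at h
  calc ψ k ≤ a • ψ t + b • ψ s := h
    _ ≤ a • ψ s + b • ψ s := by gcongr; exact hbig s (hk.trans hks)
    _ = ψ s := by rw [← add_smul, hab, one_smul]

variable {α : Type*} [MeasurableSpace α] {μ : Measure α}

/-- The de la Vallée Poussin criterion. -/
theorem exists_tail_le_of_superlinear
    (hsuper : Tendsto (fun s : ℝ => ψ s / ENNReal.ofReal s) atTop (𝓝 ⊤))
    {C : ℝ≥0∞} (hC : C ≠ ⊤) {δ : ℝ} (hδ : 0 < δ) :
    ∃ k₀ : ℕ, ∀ k : ℕ, k₀ ≤ k → ∀ m : α → ℝ, AEStronglyMeasurable m μ →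
      ∫⁻ x, ψ (m x) ∂μ ≤ C → ∫ x, (m x - min (m x) k) ∂μ ≤ δ := by
  set A : ℝ≥0∞ := C / ENNReal.ofReal δ + 1
  have hA : A < ⊤ := by
    have : ENNReal.ofReal δ ≠ 0 := by simpa using hδ
    simp only [A]
    finiteness
  obtain ⟨s₀, hs₀⟩ := eventually_atTop.1 (hsuper.eventually_const_lt hA)
  obtain ⟨k₀, hk₀⟩ := exists_nat_ge (max s₀ 1)
  refine ⟨k₀, fun k hk m hm hψ => ?_⟩
  have hkr : max s₀ 1 ≤ (k : ℝ) := hk₀.trans (by exact_mod_cast hk)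
  have hA0 : A ≠ 0 := by simp [A]
  have hpt : ∀ x, ENNReal.ofReal (m x - min (m x) k) ≤ A⁻¹ * ψ (m x) := by
    intro x
    rcases le_total (m x) k with h | h
    · simp [min_eq_left h]
    · have h1 : (1 : ℝ) ≤ m x := (le_max_right _ _).trans (hkr.trans h)
      have h2 := (hs₀ (m x) ((le_max_left _ _).trans (hkr.trans h))).le
      rw [ENNReal.le_div_iff_mul_le (Or.inl (by simp; linarith)) (Or.inl ENNReal.ofReal_ne_top)]
        at h2
      calc ENNReal.ofReal (m x - min (m x) k) ≤ ENNReal.ofReal (m x) := by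
            refine ENNReal.ofReal_le_ofReal ?_
            rw [min_eq_right h]
            linarith [(Nat.cast_nonneg k : (0 : ℝ) ≤ k)]
        _ = A⁻¹ * (A * ENNReal.ofReal (m x)) := by
            rw [← mul_assoc, ENNReal.inv_mul_cancel hA0 hA.ne, one_mul]
        _ ≤ A⁻¹ * ψ (m x) := by gcongr
  have hle : ∫⁻ x, ENNReal.ofReal (m x - min (m x) k) ∂μ ≤ ENNReal.ofReal δ := by
    calc ∫⁻ x, ENNReal.ofReal (m x - min (m x) k) ∂μ
        ≤ ∫⁻ x, A⁻¹ * ψ (m x) ∂μ := lintegral_mono hpt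
      _ ≤ A⁻¹ * C := by
          rw [lintegral_const_mul' _ _ (ENNReal.inv_ne_top.2 hA0)]
          gcongr
      _ ≤ ENNReal.ofReal δ := by
          rw [mul_comm, ← div_eq_mul_inv]
          refine ENNReal.div_le_of_le_mul ?_
          rw [mul_comm]
          calc C = C / ENNReal.ofReal δ * ENNReal.ofReal δ :=
                (ENNReal.div_mul_cancel (by simpa using hδ) ENNReal.ofReal_ne_top).symm
            _ ≤ A * ENNReal.ofReal δ := by gcongr; exact le_self_add
  rw [integral_eq_lintegral_of_nonneg_ae (ae_of_all _ fun x => sub_nonneg.2 (min_le_left _ _))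
    (hm.sub (hm.inf aestronglyMeasurable_const))]
  exact ENNReal.toReal_le_of_le_ofReal hδ.le hle

theorem convex_lintegral_le (hconv : ConvexOn ℝ≥0 univ ψ) (hψ : Measurable ψ) (B : ℝ≥0∞) :
    Convex ℝ {g : Lp ℝ 2 μ | ∫⁻ x, ψ (g x) ∂μ ≤ B} := by
  intro f hf g hg a b ha hb hab
  lift a to ℝ≥0 using ha
  lift b to ℝ≥0 using hb
  have hab' : a + b = 1 := by exact_mod_cast hab
  rw [mem_ofPred_eq] at *
  have hm : ∀ h : Lp ℝ 2 μ, Measurable fun x => ψ (h x) := fun h =>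
    hψ.comp (Lp.stronglyMeasurable h).measurable
  calc ∫⁻ x, ψ (((a : ℝ) • f + (b : ℝ) • g : Lp ℝ 2 μ) x) ∂μ
      ≤ ∫⁻ x, ((a : ℝ≥0∞) * ψ (f x) + (b : ℝ≥0∞) * ψ (g x)) ∂μ := by
        refine lintegral_mono_ae ?_
        filter_upwards [Lp.coeFn_add ((a : ℝ) • f) ((b : ℝ) • g), Lp.coeFn_smul (a : ℝ) f,
          Lp.coeFn_smul (b : ℝ) g] with x h1 h2 h3
        rw [h1, Pi.add_apply, h2, h3]
        exact hconv.2 (mem_univ (f x)) (mem_univ (g x)) zero_le zero_le hab'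
    _ = a * ∫⁻ x, ψ (f x) ∂μ + b * ∫⁻ x, ψ (g x) ∂μ := by
        rw [lintegral_add_left ((hm f).const_mul _), lintegral_const_mul _ (hm f),
          lintegral_const_mul _ (hm g)]
    _ ≤ a * B + b * B := by gcongr
    _ = B := by rw [← add_mul, ← ENNReal.coe_add, hab', ENNReal.coe_one, one_mul]

theorem lintegral_le_of_tendsto (hlsc : LowerSemicontinuous ψ) {f : ℕ → α → ℝ} {g : α → ℝ}
    (hf : ∀ n, AEMeasurable (f n) μ) (h : ∀ᵐ x ∂μ, Tendsto (fun n => f n x) atTop (𝓝 (g x)))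
    {B : ℝ≥0∞} (hB : ∀ᶠ n in atTop, ∫⁻ x, ψ (f n x) ∂μ ≤ B) : ∫⁻ x, ψ (g x) ∂μ ≤ B :=
  calc ∫⁻ x, ψ (g x) ∂μ ≤ ∫⁻ x, liminf (fun n => ψ (f n x)) atTop ∂μ := by
        refine lintegral_mono_ae ?_
        filter_upwards [h] with x hx
        exact (LowerSemicontinuousAt.le_liminf (hlsc (g x))).trans hx.liminf_le_liminf_comp
    _ ≤ liminf (fun n => ∫⁻ x, ψ (f n x) ∂μ) atTop :=
        lintegral_liminf_le' fun n => hlsc.measurable.comp_aemeasurable (hf n)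
    _ ≤ B := liminf_le_of_frequently_le' hB.frequently

theorem isClosed_lintegral_le (hlsc : LowerSemicontinuous ψ) (B : ℝ≥0∞) :
    IsClosed {g : Lp ℝ 2 μ | ∫⁻ x, ψ (g x) ∂μ ≤ B} := by
  refine IsSeqClosed.isClosed fun f g hf hfg => ?_
  obtain ⟨ns, -, hae⟩ := (tendstoInMeasure_of_tendsto_Lp hfg).exists_seq_tendsto_ae
  exact lintegral_le_of_tendsto hlsc
    (fun n => (Lp.stronglyMeasurable (f (ns n))).measurable.aemeasurable) hae
    (Eventually.of_forall fun n => hf (ns n))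

theorem IsTruncLimit.lintegral_le [IsFiniteMeasure μ] {U : Ultrafilter ℕ} {mn : ℕ → α → ℝ}
    {hm : ∀ n, AEStronglyMeasurable (mn n) μ} {h0 : ∀ n, ∀ᵐ x ∂μ, 0 ≤ mn n x}
    {M : ℕ → Lp ℝ 2 μ} {m : α → ℝ} (h : IsTruncLimit U hm h0 M m)
    (hconv : ConvexOn ℝ≥0 univ ψ) (hlsc : LowerSemicontinuous ψ)
    (hsuper : Tendsto (fun s : ℝ => ψ s / ENNReal.ofReal s) atTop (𝓝 ⊤)) {B : ℝ≥0∞}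
    (hB : ∀ᶠ n in (U : Filter ℕ), ∫⁻ x, ψ (mn n x) ∂μ ≤ B) : ∫⁻ x, ψ (m x) ∂μ ≤ B := by
  obtain ⟨k₀, hk₀⟩ := exists_le_of_superlinear hconv hsuper
  refine lintegral_le_of_tendsto hlsc
    (fun k => (Lp.stronglyMeasurable (M k)).measurable.aemeasurable) h.tendsto ?_
  filter_upwards [eventually_ge_atTop k₀] with k hk
  refine weak_limit_mem (K := {g : Lp ℝ 2 μ | ∫⁻ x, ψ (g x) ∂μ ≤ B})
    (convex_lintegral_le hconv hlsc.measurable B) (isClosed_lintegral_le hlsc B) ?_ (h.weak k)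
  filter_upwards [hB] with n hn
  refine le_trans (lintegral_mono_ae ?_) hn
  filter_upwards [coeFn_truncL2 (hm n) (h0 n) k] with x hx
  rw [hx]
  rcases le_total (mn n x) k with h | h
  · rw [min_eq_left h]
  · rw [min_eq_right h]
    exact hk₀ _ _ (by exact_mod_cast hk) h

end Superlinear

end OptPot

namespace OptPot

section UpperIntegral

variable {α : Type*} [MeasurableSpace α] {μ : Measure α}

theorem extIntegral_coe {r : α → ℝ} (hr : Integrable r μ) :
    extIntegral μ (fun x => (r x : EReal)) = ((∫ x, r x ∂μ : ℝ) : EReal) := by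
  have h1 : ∫⁻ x, ENNReal.ofReal (r x) ∂μ ≠ ⊤ := hr.lintegral_lt_top.ne
  have h2 : ∫⁻ x, ENNReal.ofReal (-r x) ∂μ ≠ ⊤ := hr.neg.lintegral_lt_top.ne
  rw [integral_eq_lintegral_pos_part_sub_lintegral_neg_part hr, extIntegral, EReal.coe_sub,
    EReal.coe_ennreal_toReal h1, EReal.coe_ennreal_toReal h2]
  rfl

theorem upperIntegral_le_integral {g : α → EReal} {r : α → ℝ} (hr : Integrable r μ)
    (hg : ∀ᵐ x ∂μ, g x ≤ (r x : EReal)) : upperIntegral μ g ≤ ((∫ x, r x ∂μ : ℝ) : EReal) := by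
  have hm := hr.aestronglyMeasurable
  have hae : ∀ᵐ x ∂μ, r x = hm.mk r x := hm.ae_eq_mk
  rw [integral_congr_ae hae, ← extIntegral_coe (hr.congr hae)]
  refine iInf₂_le_of_le _ (measurable_coe_real_ereal.comp hm.stronglyMeasurable_mk.measurable)
    (iInf_le_of_le ?_ le_rfl)
  filter_upwards [hg, hae] with x h1 h2
  rw [Function.comp_apply, ← h2]
  exact h1

theorem exists_integrable_of_upperIntegral_lt {g : α → EReal} {b : α → ℝ} (hb : Integrable b μ)
    (hg : ∀ᵐ x ∂μ, ((-b x : ℝ) : EReal) ≤ g x) {A : ℝ} (hA : upperIntegral μ g < (A : EReal)) :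
    ∃ r : α → ℝ, Integrable r μ ∧ (∀ᵐ x ∂μ, g x ≤ (r x : EReal)) ∧ ∫ x, r x ∂μ ≤ A := by
  simp only [upperIntegral, iInf_lt_iff] at hA
  obtain ⟨h, hm, hgh, hlt⟩ := hA
  have hmP : Measurable fun x => (h x).toENNReal := hm.ereal_toENNReal
  have hmN : Measurable fun x => (-h x).toENNReal := hm.neg.ereal_toENNReal
  have hN : ∫⁻ x, (-h x).toENNReal ∂μ ≠ ⊤ := by
    refine ne_top_of_le_ne_top hb.lintegral_lt_top.ne (lintegral_mono_ae ?_)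
    filter_upwards [hg, hgh] with x h1 h2
    have h3 : -h x ≤ ((b x : ℝ) : EReal) := by
      rw [EReal.neg_le, ← EReal.coe_neg]
      exact h1.trans h2
    simpa using EReal.toENNReal_le_toENNReal h3
  have hP : ∫⁻ x, (h x).toENNReal ∂μ ≠ ⊤ := by
    intro htop
    rw [extIntegral, htop] at hlt
    lift ∫⁻ x, (-h x).toENNReal ∂μ to ℝ≥0 using hN with N
    simp at hlt
  refine ⟨fun x => (h x).toENNReal.toReal - (-h x).toENNReal.toReal,
    (integrable_toReal_of_lintegral_ne_top hmP.aemeasurable hP).sub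
      (integrable_toReal_of_lintegral_ne_top hmN.aemeasurable hN), ?_, ?_⟩
  · filter_upwards [hgh, ae_lt_top hmP hP, ae_lt_top hmN hN] with x h1 h2 h3
    refine h1.trans (le_of_eq ?_)
    induction hx : h x with
    | bot => simp [hx] at h3
    | top => simp [hx] at h2
    | coe y =>
      rw [← EReal.coe_neg, EReal.toENNReal_of_ne_top (by simp), EReal.toENNReal_of_ne_top (by simp),
        EReal.toReal_coe, EReal.toReal_coe]
      norm_cast
      rcases le_total 0 y with hy | hy
      · simp [ENNReal.toReal_ofReal hy, ENNReal.ofReal_of_nonpos (neg_nonpos.2 hy)]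
      · simp [ENNReal.toReal_ofReal (neg_nonneg.2 hy), ENNReal.ofReal_of_nonpos hy]
  · rw [integral_sub (integrable_toReal_of_lintegral_ne_top hmP.aemeasurable hP)
      (integrable_toReal_of_lintegral_ne_top hmN.aemeasurable hN),
      integral_toReal hmP.aemeasurable (ae_lt_top hmP hP),
      integral_toReal hmN.aemeasurable (ae_lt_top hmN hN)]
    rw [extIntegral] at hlt
    lift ∫⁻ x, (-h x).toENNReal ∂μ to ℝ≥0 using hN with N
    lift ∫⁻ x, (h x).toENNReal ∂μ to ℝ≥0 using hP with P
    simp only [ENNReal.coe_toReal, EReal.coe_nnreal_eq_coe_real] at *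
    exact_mod_cast hlt.le

theorem ofReal_add_le_of_coe_add_le {y b r : ℝ} {t : ℝ≥0∞} (hy : 0 ≤ y + b)
    (h : (y : EReal) + (t : EReal) ≤ (r : EReal)) :
    ENNReal.ofReal (y + b) + t ≤ ENNReal.ofReal (r + b) := by
  induction t with
  | top => simp at h
  | coe t =>
    rw [EReal.coe_nnreal_eq_coe_real] at h
    have h' : y + t ≤ r := by exact_mod_cast h
    rw [← ENNReal.ofReal_coe_nnreal, ← ENNReal.ofReal_add hy t.coe_nonneg]
    exact ENNReal.ofReal_le_ofReal (by linarith)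

theorem coe_add_le_of_ofReal_add_le {y b : ℝ} {s t : ℝ≥0∞} (hy : 0 ≤ y + b) (hs : s ≠ ⊤)
    (h : ENNReal.ofReal (y + b) + t ≤ s) :
    (y : EReal) + (t : EReal) ≤ ((s.toReal - b : ℝ) : EReal) := by
  induction t with
  | top => simp at h; exact absurd h hs
  | coe t =>
    rw [EReal.coe_nnreal_eq_coe_real]
    rw [← ENNReal.ofReal_coe_nnreal, ← ENNReal.ofReal_add hy t.coe_nonneg,
      ENNReal.ofReal_le_iff_le_toReal hs] at h
    have : y + t ≤ s.toReal - b := by linarith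
    exact_mod_cast this

variable {ψ : ℝ → ℝ≥0∞}

theorem lintegral_le_of_coe_add_le {y b r m : α → ℝ} (hb : Integrable b μ)
    (hr : Integrable r μ) (hy : ∀ᵐ x ∂μ, 0 ≤ y x + b x)
    (h : ∀ᵐ x ∂μ, (y x : EReal) + (ψ (m x) : EReal) ≤ (r x : EReal)) :
    ∫⁻ x, ENNReal.ofReal (r x + b x) ∂μ = ENNReal.ofReal (∫ x, r x ∂μ + ∫ x, b x ∂μ) ∧
      0 ≤ ∫ x, r x ∂μ + ∫ x, b x ∂μ ∧
      ∫⁻ x, ψ (m x) ∂μ ≤ ENNReal.ofReal (∫ x, r x ∂μ + ∫ x, b x ∂μ) := by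
  have hnn : ∀ᵐ x ∂μ, 0 ≤ r x + b x := by
    filter_upwards [hy, h] with x h1 h2
    have h3 : (y x : EReal) ≤ r x := (le_add_of_nonneg_right (EReal.coe_ennreal_nonneg _)).trans h2
    have h4 : y x ≤ r x := by exact_mod_cast h3
    linarith
  have he : ∫⁻ x, ENNReal.ofReal (r x + b x) ∂μ =
      ENNReal.ofReal (∫ x, r x ∂μ + ∫ x, b x ∂μ) := by
    rw [← integral_add hr hb]
    exact (ofReal_integral_eq_lintegral_ofReal (hr.add hb) hnn).symm
  refine ⟨he, ?_, ?_⟩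
  · rw [← integral_add hr hb]
    exact integral_nonneg_of_ae hnn
  · rw [← he]
    refine lintegral_mono_ae ?_
    filter_upwards [hy, h] with x h1 h2
    exact le_add_self.trans (ofReal_add_le_of_coe_add_le h1 h2)

/-- Lower semicontinuity of the cost along a sequence `(y_n, m_n)`, where the first term of the cost
is lower semicontinuous for the pointwise convergence, and the second one for the convergence of
`m_n` to `m` along the ultrafilter `U`. -/
theorem upperIntegral_le_of_liminf {U : Ultrafilter ℕ} (hU : (U : Filter ℕ) ≤ atTop)
    (hψ : Measurable ψ) {y b r mn : ℕ → α → ℝ} {y₀ b₀ m : α → ℝ}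
    (hm : ∀ n, AEMeasurable (mn n) μ) (hm₀ : AEMeasurable m μ)
    (hb : ∀ n, Integrable (b n) μ) (hb₀ : Integrable b₀ μ)
    (hbt : Tendsto (fun n => ∫ x, b n x ∂μ) atTop (𝓝 (∫ x, b₀ x ∂μ)))
    (hy : ∀ n, ∀ᵐ x ∂μ, 0 ≤ y n x + b n x) (hy₀ : ∀ᵐ x ∂μ, 0 ≤ y₀ x + b₀ x)
    (hlsc : ∀ᵐ x ∂μ, ENNReal.ofReal (y₀ x + b₀ x) ≤
      liminf (fun n => ENNReal.ofReal (y n x + b n x)) atTop)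
    (hr : ∀ n, Integrable (r n) μ)
    (hyr : ∀ n, ∀ᵐ x ∂μ, (y n x : EReal) + (ψ (mn n x) : EReal) ≤ (r n x : EReal))
    (hψm : ∀ B, (∀ᶠ n in (U : Filter ℕ), ∫⁻ x, ψ (mn n x) ∂μ ≤ B) → ∫⁻ x, ψ (m x) ∂μ ≤ B)
    {A : ℝ} (hA : ∀ᶠ n in atTop, ∫ x, r n x ∂μ ≤ A) :
    upperIntegral μ (fun x => (y₀ x : EReal) + (ψ (m x) : EReal)) ≤ (A : EReal) := by
  set p : ℕ → α → ℝ≥0∞ := fun n x => ENNReal.ofReal (r n x + b n x)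
  set q : ℕ → α → ℝ≥0∞ := fun n x => p n x - ψ (mn n x)
  have hpm : ∀ n, AEMeasurable (p n) μ := fun n =>
    ((hr n).add (hb n)).aestronglyMeasurable.aemeasurable.ennreal_ofReal
  have hψmeas : ∀ n, AEMeasurable (fun x => ψ (mn n x)) μ := fun n => hψ.comp_aemeasurable (hm n)
  have hqm : ∀ n, AEMeasurable (q n) μ := fun n => (hpm n).sub (hψmeas n)
  have hpq : ∀ n, ∀ᵐ x ∂μ, ENNReal.ofReal (y n x + b n x) ≤ q n x ∧ ψ (mn n x) + q n x = p n x := by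
    intro n
    filter_upwards [hy n, hyr n] with x h1 h2
    have h3 := ofReal_add_le_of_coe_add_le h1 h2
    have h4 : ψ (mn n x) ≤ p n x := le_add_self.trans h3
    exact ⟨ENNReal.le_sub_of_add_le_right (ne_top_of_le_ne_top ENNReal.ofReal_ne_top h4) h3,
      add_tsub_cancel_of_le h4⟩
  have hsum : ∀ n, ∫⁻ x, ψ (mn n x) ∂μ + ∫⁻ x, q n x ∂μ =
      ENNReal.ofReal (∫ x, r n x ∂μ + ∫ x, b n x ∂μ) := by
    intro n
    rw [← (lintegral_le_of_coe_add_le (hb n) (hr n) (hy n) (hyr n)).1,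
      ← lintegral_add_left' (hψmeas n)]
    exact lintegral_congr_ae ((hpq n).mono fun x hx => hx.2)
  have hlim : Tendsto (fun n => A + ∫ x, b n x ∂μ) atTop (𝓝 (A + ∫ x, b₀ x ∂μ)) :=
    hbt.const_add A
  have hA0 : 0 ≤ A + ∫ x, b₀ x ∂μ := by
    refine ge_of_tendsto hlim ?_
    filter_upwards [hA] with n hn
    linarith [(lintegral_le_of_coe_add_le (hb n) (hr n) (hy n) (hyr n)).2.1]
  obtain ⟨S, -, hS⟩ := isCompact_univ.ultrafilter_le_nhds
    (U.map fun n => ∫⁻ x, ψ (mn n x) ∂μ) (by simp)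
  obtain ⟨Q, -, hQ⟩ := isCompact_univ.ultrafilter_le_nhds
    (U.map fun n => ∫⁻ x, q n x ∂μ) (by simp)
  have hS' : Tendsto (fun n => ∫⁻ x, ψ (mn n x) ∂μ) U (𝓝 S) := hS
  have hQ' : Tendsto (fun n => ∫⁻ x, q n x ∂μ) U (𝓝 Q) := hQ
  have hSQ : S + Q ≤ ENNReal.ofReal (A + ∫ x, b₀ x ∂μ) := by
    refine le_of_tendsto_of_tendsto (hS'.add hQ')
      (ENNReal.tendsto_ofReal (hlim.mono_left hU)) ?_
    filter_upwards [hU hA] with n hn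
    rw [hsum n]
    exact ENNReal.ofReal_le_ofReal (by linarith [hn])
  have hψS : ∫⁻ x, ψ (m x) ∂μ ≤ S := by
    refine le_of_forall_gt_imp_ge_of_dense fun B hB => ?_
    exact hψm B ((hS'.eventually_lt_const hB).mono fun n hn => hn.le)
  have hqQ : ∫⁻ x, liminf (fun n => q n x) atTop ∂μ ≤ Q :=
    calc ∫⁻ x, liminf (fun n => q n x) atTop ∂μ
        ≤ liminf (fun n => ∫⁻ x, q n x ∂μ) atTop := lintegral_liminf_le' hqm
      _ ≤ liminf (fun n => ∫⁻ x, q n x ∂μ) U := liminf_le_liminf_of_le hU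
      _ = Q := hQ'.liminf_eq
  set s : α → ℝ≥0∞ := fun x => liminf (fun n => q n x) atTop + ψ (m x)
  have hψm₀ : AEMeasurable (fun x => ψ (m x)) μ := hψ.comp_aemeasurable hm₀
  have hsm : AEMeasurable s μ := by
    simp only [s, liminf_eq_iSup_iInf_of_nat']
    exact (AEMeasurable.iSup fun n => AEMeasurable.iInf fun i => hqm (i + n)).add hψm₀
  have hs : ∫⁻ x, s x ∂μ ≤ ENNReal.ofReal (A + ∫ x, b₀ x ∂μ) := by
    rw [lintegral_add_right' _ hψm₀, add_comm]
    exact (add_le_add hψS hqQ).trans hSQ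
  have hs_top : ∫⁻ x, s x ∂μ ≠ ⊤ := ne_top_of_le_ne_top ENNReal.ofReal_ne_top hs
  have hsf : ∀ᵐ x ∂μ, s x < ⊤ := ae_lt_top' hsm hs_top
  have hsi : Integrable (fun x => (s x).toReal) μ :=
    integrable_toReal_of_lintegral_ne_top hsm hs_top
  refine (upperIntegral_le_integral (hsi.sub hb₀) ?_).trans ?_
  · filter_upwards [hsf, hlsc, hy₀, ae_all_iff.2 hpq] with x h1 h2 h3 h4
    refine coe_add_le_of_ofReal_add_le h3 h1.ne ?_
    refine add_le_add (h2.trans ?_) le_rfl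
    exact liminf_le_liminf (Eventually.of_forall fun n => (h4 n).1)
  · have h1 : (∫⁻ x, s x ∂μ).toReal ≤ A + ∫ x, b₀ x ∂μ := ENNReal.toReal_le_of_le_ofReal hA0 hs
    simp only [Pi.sub_apply]
    rw [integral_sub hsi hb₀, integral_toReal hsm hsf]
    exact_mod_cast (by linarith)

end UpperIntegral

end OptPot

namespace OptPot

/-- The truncation of `s` at the levels `-k` and `k`. -/
noncomputable def clip (k s : ℝ) : ℝ := max (-k) (min k s)

theorem continuous_clip (k : ℝ) : Continuous (clip k) :=
  continuous_const.max (continuous_const.min continuous_id)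

theorem abs_clip_le {k : ℝ} (hk : 0 ≤ k) (s : ℝ) : |clip k s| ≤ k :=
  abs_le.2 ⟨le_max_left _ _, max_le (by linarith) (min_le_left _ _)⟩

theorem clip_eq_self {k s : ℝ} (h : |s| ≤ k) : clip k s = s := by
  rw [clip, min_eq_right (abs_le.1 h).2, max_eq_right (abs_le.1 h).1]

theorem tendsto_clip (s : ℝ) : Tendsto (fun k : ℕ => clip k s) atTop (𝓝 s) := by
  refine tendsto_const_nhds.congr' ?_
  obtain ⟨k₀, hk₀⟩ := exists_nat_ge |s|
  filter_upwards [eventually_ge_atTop k₀] with k hk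
  exact (clip_eq_self (hk₀.trans (by exact_mod_cast hk))).symm

theorem abs_clip_le_abs {k : ℝ} (hk : 0 ≤ k) (s : ℝ) : |clip k s| ≤ |s| := by
  rcases le_total |s| k with h | h
  · rw [clip_eq_self h]
  · exact (abs_clip_le hk s).trans h

theorem clip_sq_le {k : ℝ} (hk : 0 ≤ k) (s : ℝ) : clip k s ^ 2 ≤ s ^ 2 :=
  sq_le_sq.2 (abs_clip_le_abs hk s)

theorem abs_sub_clip_le {k : ℝ} (hk : 0 < k) (s : ℝ) : |s - clip k s| ≤ s ^ 2 / k := by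
  rcases le_total |s| k with h | h
  · rw [clip_eq_self h, sub_self, abs_zero]
    positivity
  · have h1 : |s - clip k s| ≤ |s| := by
      rcases le_total 0 s with h0 | h0
      · rw [abs_of_nonneg h0] at h
        rw [clip, min_eq_left h, max_eq_right (by linarith), abs_of_nonneg (by linarith),
          abs_of_nonneg h0]
        linarith
      · rw [abs_of_nonpos h0] at h
        rw [clip, min_eq_right (by linarith), max_eq_left (by linarith), abs_of_nonpos (by linarith),
          abs_of_nonpos h0]
        linarith
    refine h1.trans ?_
    rw [le_div_iff₀ hk, ← sq_abs, sq]
    exact mul_le_mul_of_nonneg_left h (abs_nonneg _)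

section Weighted

variable {α : Type*} [MeasurableSpace α] {μ : Measure α}

theorem integrable_weight_mul_mul {m v w : α → ℝ} (hm : AEStronglyMeasurable m μ)
    (h0 : ∀ᵐ x ∂μ, 0 ≤ m x) (hvm : AEStronglyMeasurable v μ) (hwm : AEStronglyMeasurable w μ)
    (hv : Integrable (fun x => m x * v x ^ 2) μ) (hw : Integrable (fun x => m x * w x ^ 2) μ) :
    Integrable (fun x => m x * v x * w x) μ := by
  refine (hv.add hw).mono ((hm.mul hvm).mul hwm) ?_
  filter_upwards [h0] with x hx
  simp only [Pi.add_apply]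
  rw [mul_assoc, norm_mul, norm_mul (v x), ← mul_add, norm_mul, Real.norm_of_nonneg hx,
    Real.norm_of_nonneg (by positivity : 0 ≤ v x ^ 2 + w x ^ 2), Real.norm_eq_abs, Real.norm_eq_abs,
    ← sq_abs (v x), ← sq_abs (w x)]
  refine mul_le_mul_of_nonneg_left ?_ hx
  nlinarith [sq_nonneg (|v x| - |w x|), sq_nonneg |v x|, sq_nonneg |w x|]

theorem abs_integral_sub_clip_le {m v w : α → ℝ} (hm : Integrable m μ)
    (h0 : ∀ᵐ x ∂μ, 0 ≤ m x) (hvm : AEStronglyMeasurable v μ) (hwm : AEStronglyMeasurable w μ)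
    (hw : Integrable (fun x => m x * w x ^ 2) μ) {V : ℝ} (hV : ∀ᵐ x ∂μ, |v x| ≤ V)
    {k : ℝ} (hk : 0 < k) :
    |∫ x, m x * w x * v x ∂μ - ∫ x, m x * (clip k (w x) * v x) ∂μ| ≤
      V / k * ∫ x, m x * w x ^ 2 ∂μ := by
  have hv2 : Integrable (fun x => m x * v x ^ 2) μ := by
    refine hm.mul_bdd (c := V ^ 2) (hvm.pow 2) ?_
    filter_upwards [hV] with x hx
    rw [norm_pow, Real.norm_eq_abs]
    exact pow_le_pow_left₀ (abs_nonneg _) hx 2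
  have hc : AEStronglyMeasurable (fun x => clip k (w x)) μ :=
    (continuous_clip k).comp_aestronglyMeasurable hwm
  have h2 : Integrable (fun x => m x * (clip k (w x) * v x)) μ := by
    refine hm.mul_bdd (c := k * V) (hc.mul hvm) ?_
    filter_upwards [hV] with x hx
    rw [norm_mul]
    exact mul_le_mul (abs_clip_le hk.le _) hx (abs_nonneg _) hk.le
  rw [← integral_sub (integrable_weight_mul_mul hm.1 h0 hwm hvm hw hv2) h2, ← integral_const_mul,
    ← Real.norm_eq_abs]
  refine norm_integral_le_of_norm_le (hw.const_mul _) ?_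
  filter_upwards [h0, hV] with x h0 hx
  have e : m x * w x * v x - m x * (clip k (w x) * v x) = m x * ((w x - clip k (w x)) * v x) := by
    ring
  rw [e, norm_mul, norm_mul, Real.norm_of_nonneg h0]
  calc m x * (‖w x - clip k (w x)‖ * ‖v x‖) ≤ m x * (w x ^ 2 / k * V) := by
        gcongr
        · exact abs_sub_clip_le hk _
        · exact hx
    _ = V / k * (m x * w x ^ 2) := by ring

variable [IsFiniteMeasure μ] {U : Ultrafilter ℕ} {mn : ℕ → α → ℝ}
  {hm : ∀ n, AEStronglyMeasurable (mn n) μ} {h0 : ∀ n, ∀ᵐ x ∂μ, 0 ≤ mn n x}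
  {M : ℕ → Lp ℝ 2 μ} {m : α → ℝ} {un : ℕ → α → ℝ} {u : α → ℝ} {D : ℝ}

theorem IsTruncLimit.integrable_weight (h : IsTruncLimit U hm h0 M m)
    (hU : (U : Filter ℕ) ≤ atTop) (hi : ∀ n, Integrable (mn n) μ)
    (htail : ∀ δ : ℝ, 0 < δ → ∃ k₀ : ℕ, ∀ k ≥ k₀, ∀ n, ∫ x, (mn n x - min (mn n x) k) ∂μ ≤ δ)
    (hum : ∀ n, AEStronglyMeasurable (un n) μ)
    (hu : ∀ᵐ x ∂μ, Tendsto (fun n => un n x) atTop (𝓝 (u x)))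
    (hw : ∀ n, Integrable (fun x => mn n x * un n x ^ 2) μ)
    (hD : ∀ n, ∫ x, mn n x * un n x ^ 2 ∂μ ≤ D) :
    Integrable (fun x => m x * u x ^ 2) μ := by
  have hum₀ : AEStronglyMeasurable u μ := aestronglyMeasurable_of_tendsto_ae atTop hum hu
  have hmm := h.integrable.aestronglyMeasurable
  have hcm : ∀ (k : ℝ) {w : α → ℝ}, AEStronglyMeasurable w μ →
      AEStronglyMeasurable (fun x => clip k (w x) ^ 2) μ := fun k w hw =>
    ((continuous_clip k).comp_aestronglyMeasurable hw).pow 2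
  have hcb : ∀ (k : ℕ) (s : ℝ), |clip k s ^ 2| ≤ (k : ℝ) ^ 2 := fun k s => by
    rw [abs_pow]
    exact pow_le_pow_left₀ (abs_nonneg _) (abs_clip_le (Nat.cast_nonneg k) s) 2
  have hk : ∀ k : ℕ, ∫ x, m x * clip k (u x) ^ 2 ∂μ ≤ D := fun k => by
    refine le_of_tendsto (h.tendsto_integral_mul hU hi htail (gn := fun n x => clip k (un n x) ^ 2)
      (G := (k : ℝ) ^ 2) (fun n => hcm k (hum n)) (fun n => ae_of_all _ fun x => hcb k _) ?_)
      (Eventually.of_forall fun n => le_trans ?_ (hD n))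
    · filter_upwards [hu] with x hx
      exact (((continuous_clip k).tendsto _).comp hx).pow 2
    · refine integral_mono_ae ((hi n).mul_bdd (c := (k : ℝ) ^ 2) (hcm k (hum n))
        (ae_of_all _ fun x => hcb k _)) (hw n) ?_
      filter_upwards [h0 n] with x hx
      exact mul_le_mul_of_nonneg_left (clip_sq_le (Nat.cast_nonneg k) _) hx
  refine ⟨hmm.mul (hum₀.pow 2), ?_⟩
  have hnn : ∀ᵐ x ∂μ, 0 ≤ m x * u x ^ 2 := by
    filter_upwards [h.nonneg] with x hx using mul_nonneg hx (sq_nonneg _)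
  rw [hasFiniteIntegral_iff_ofReal hnn]
  refine lt_of_le_of_lt ?_ (ENNReal.ofReal_lt_top (r := D))
  calc ∫⁻ x, ENNReal.ofReal (m x * u x ^ 2) ∂μ
      = ∫⁻ x, liminf (fun k : ℕ => ENNReal.ofReal (m x * clip k (u x) ^ 2)) atTop ∂μ := by
        refine lintegral_congr fun x => (Tendsto.liminf_eq ?_).symm
        exact ENNReal.tendsto_ofReal (((tendsto_clip (u x)).pow 2).const_mul _)
    _ ≤ liminf (fun k : ℕ => ∫⁻ x, ENNReal.ofReal (m x * clip k (u x) ^ 2) ∂μ) atTop :=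
        lintegral_liminf_le' fun k => (hmm.mul (hcm k hum₀)).aemeasurable.ennreal_ofReal
    _ ≤ ENNReal.ofReal D := by
        refine liminf_le_of_frequently_le' (Eventually.frequently (Eventually.of_forall fun k => ?_))
        rw [← ofReal_integral_eq_lintegral_ofReal]
        · exact ENNReal.ofReal_le_ofReal (hk k)
        · exact h.integrable.mul_bdd (c := (k : ℝ) ^ 2) (hcm k hum₀) (ae_of_all _ fun x => hcb k _)
        · filter_upwards [h.nonneg] with x hx using mul_nonneg hx (sq_nonneg _)

theorem IsTruncLimit.tendsto_integral_mul_mul (h : IsTruncLimit U hm h0 M m)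
    (hU : (U : Filter ℕ) ≤ atTop) (hi : ∀ n, Integrable (mn n) μ)
    (htail : ∀ δ : ℝ, 0 < δ → ∃ k₀ : ℕ, ∀ k ≥ k₀, ∀ n, ∫ x, (mn n x - min (mn n x) k) ∂μ ≤ δ)
    (hum : ∀ n, AEStronglyMeasurable (un n) μ)
    (hu : ∀ᵐ x ∂μ, Tendsto (fun n => un n x) atTop (𝓝 (u x)))
    (hw : ∀ n, Integrable (fun x => mn n x * un n x ^ 2) μ)
    (hD : ∀ n, ∫ x, mn n x * un n x ^ 2 ∂μ ≤ D)
    {v : α → ℝ} (hvm : AEStronglyMeasurable v μ) {V : ℝ} (hV : ∀ᵐ x ∂μ, |v x| ≤ V) :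
    Tendsto (fun n => ∫ x, mn n x * un n x * v x ∂μ) U (𝓝 (∫ x, m x * u x * v x ∂μ)) := by
  have hum₀ : AEStronglyMeasurable u μ := aestronglyMeasurable_of_tendsto_ae atTop hum hu
  have hw₀ := h.integrable_weight hU hi htail hum hu hw hD
  have hV' : ∀ᵐ x ∂μ, |v x| ≤ |V| := hV.mono fun x hx => hx.trans (le_abs_self V)
  set E : ℝ := |D| + |∫ x, m x * u x ^ 2 ∂μ|
  have hsmall : Tendsto (fun k : ℕ => |V| / k * E) atTop (𝓝 0) := by
    simpa using (tendsto_const_div_atTop_nhds_zero_nat |V|).mul_const E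
  rw [Metric.tendsto_nhds]
  intro ε hε
  obtain ⟨k, hk1, hk0⟩ := ((hsmall.eventually_lt_const (show 0 < ε / 4 by positivity)).and
    (eventually_gt_atTop 0)).exists
  have hkpos : (0 : ℝ) < k := by exact_mod_cast hk0
  have hconv : Tendsto (fun n => ∫ x, mn n x * (clip k (un n x) * v x) ∂μ) U
      (𝓝 (∫ x, m x * (clip k (u x) * v x) ∂μ)) := by
    refine h.tendsto_integral_mul hU hi htail (G := k * |V|)
      (fun n => ((continuous_clip k).comp_aestronglyMeasurable (hum n)).mul hvm) (fun n => ?_) ?_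
    · filter_upwards [hV'] with x hx
      rw [abs_mul]
      exact mul_le_mul (abs_clip_le hkpos.le _) hx (abs_nonneg _) hkpos.le
    · filter_upwards [hu] with x hx
      exact (((continuous_clip k).tendsto _).comp hx).mul_const _
  filter_upwards [Metric.tendsto_nhds.1 hconv (ε / 4) (by positivity)] with n hn
  have hVk : 0 ≤ |V| / k := by positivity
  have h1 := (abs_integral_sub_clip_le (hi n) (h0 n) hvm (hum n) (hw n) hV' hkpos).trans
    (mul_le_mul_of_nonneg_left (show _ ≤ E by
      linarith [hD n, le_abs_self D, abs_nonneg (∫ x, m x * u x ^ 2 ∂μ)]) hVk)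
  have h2 := (abs_integral_sub_clip_le h.integrable h.nonneg hvm hum₀ hw₀ hV' hkpos).trans
    (mul_le_mul_of_nonneg_left (show _ ≤ E by
      linarith [abs_nonneg D, le_abs_self (∫ x, m x * u x ^ 2 ∂μ)]) hVk)
  rw [Real.dist_eq] at hn ⊢
  rw [abs_lt] at hn ⊢
  rw [_root_.abs_le] at h1 h2
  constructor <;> linarith [h1.1, h1.2, h2.1, h2.2, hn.1, hn.2]

end Weighted

end OptPot

namespace OptPot

variable {N : ℕ} {Ω : Set (Eucl N)} {f : Hminus1 Ω}

theorem aestronglyMeasurable_fn (u : H10 Ω) : AEStronglyMeasurable (fn u) (leb Ω) :=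
  Lp.aestronglyMeasurable (toL2 u)

theorem integral_state {m : Eucl N → ℝ} (hm : AEStronglyMeasurable m (leb Ω))
    (h0 : ∀ᵐ x ∂(leb Ω), 0 ≤ m x) {u v : H10 Ω} (hu : MemL2Weight Ω m (fn u))
    (hv : MemL2Weight Ω m (fn v)) :
    ∫ x, (inner ℝ (grad u x) (grad v x) + m x * fn u x * fn v x) ∂(leb Ω) =
      inner ℝ (gradL2 u) (gradL2 v) + ∫ x, m x * fn u x * fn v x ∂(leb Ω) := by
  rw [L2.inner_def]
  exact integral_add (L2.integrable_inner (gradL2 u) (gradL2 v))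
    (integrable_weight_mul_mul hm h0 (aestronglyMeasurable_fn u) (aestronglyMeasurable_fn v) hu hv)

theorem memL2Weight_of_bounded {m : Eucl N → ℝ} (hm : Integrable m (leb Ω)) {v : H10 Ω} {B : ℝ}
    (hv : ∀ᵐ x ∂(leb Ω), |fn v x| ≤ B) : MemL2Weight Ω m (fn v) := by
  refine hm.mul_bdd (c := B ^ 2) ((aestronglyMeasurable_fn v).pow 2) ?_
  filter_upwards [hv] with x hx
  rw [norm_pow, Real.norm_eq_abs]
  exact pow_le_pow_left₀ (abs_nonneg _) hx 2

theorem IsAdmissible.equation {m : Eucl N → ℝ} {u : H10 Ω} (h : IsAdmissible Ω f m u) {v : H10 Ω}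
    (hv : MemL2Weight Ω m (fn v)) :
    inner ℝ (gradL2 u) (gradL2 v) + ∫ x, m x * fn u x * fn v x ∂(leb Ω) = f v := by
  rw [← integral_state h.1.1 h.2.1 h.2.2.1 hv]
  exact h.2.2.2 v hv

/-- The energy estimate. -/
theorem IsAdmissible.energy_le {K : ℝ} (hK1 : 1 ≤ K)
    (hK : ∀ u : H10 Ω, ‖u‖ ^ 2 ≤ K * ‖gradL2 u‖ ^ 2) {m : Eucl N → ℝ} {u : H10 Ω}
    (h : IsAdmissible Ω f m u) :
    ‖u‖ ≤ K * ‖f‖ ∧ ∫ x, m x * fn u x ^ 2 ∂(leb Ω) ≤ ‖f‖ * (K * ‖f‖) := by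
  have h1 := h.equation h.2.2.1
  have h2 : ∫ x, m x * fn u x * fn u x ∂(leb Ω) = ∫ x, m x * fn u x ^ 2 ∂(leb Ω) :=
    integral_congr_ae (ae_of_all _ fun x => by ring)
  have h3 : 0 ≤ ∫ x, m x * fn u x ^ 2 ∂(leb Ω) := by
    refine integral_nonneg_of_ae ?_
    filter_upwards [h.2.1] with x hx using mul_nonneg hx (sq_nonneg _)
  have h4 : f u ≤ ‖f‖ * ‖u‖ := (le_abs_self _).trans (f.le_opNorm u)
  rw [h2, real_inner_self_eq_norm_sq] at h1
  have h5 : ‖u‖ ≤ K * ‖f‖ := by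
    have h6 : ‖u‖ * ‖u‖ ≤ K * ‖f‖ * ‖u‖ := by nlinarith [hK u]
    rcases (norm_nonneg u).eq_or_lt with h7 | h7
    · rw [← h7]; positivity
    · exact le_of_mul_le_mul_right h6 h7
  refine ⟨h5, ?_⟩
  have := mul_le_mul_of_nonneg_left h5 (norm_nonneg f)
  nlinarith [sq_nonneg ‖gradL2 u‖]

/-- The equation only has to be tested with bounded functions. -/
theorem isState_of_bounded (hΩ : IsOpen Ω) {m : Eucl N → ℝ} (hm : Integrable m (leb Ω))
    (h0 : ∀ᵐ x ∂(leb Ω), 0 ≤ m x) {u : H10 Ω} (hu : MemL2Weight Ω m (fn u))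
    (h : ∀ (v : H10 Ω) (B : ℝ), (∀ᵐ x ∂(leb Ω), |fn v x| ≤ B) →
      inner ℝ (gradL2 u) (gradL2 v) + ∫ x, m x * fn u x * fn v x ∂(leb Ω) = f v) :
    IsState Ω f m u := by
  refine ⟨hu, fun v hv => ?_⟩
  rw [integral_state hm.1 h0 hu hv]
  obtain ⟨w, hwB, hwv, hlim, hF⟩ := exists_bounded_approx hΩ v
  have h1 : Tendsto (fun n => (inner ℝ (gradL2 u) (gradL2 (w n)) : ℝ)) (hyperfilter ℕ)
      (𝓝 (inner ℝ (gradL2 u) (gradL2 v))) :=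
    hF ((InnerProductSpace.toDual ℝ _ (gradL2 u)).comp (gradL2CLM Ω))
  have h2 : Tendsto (fun n => ∫ x, m x * fn u x * fn (w n) x ∂(leb Ω)) atTop
      (𝓝 (∫ x, m x * fn u x * fn v x ∂(leb Ω))) := by
    refine tendsto_integral_of_dominated_convergence (fun x => ‖m x * fn u x * fn v x‖)
      (fun n => (hm.1.mul (aestronglyMeasurable_fn u)).mul (aestronglyMeasurable_fn (w n)))
      (integrable_weight_mul_mul hm.1 h0 (aestronglyMeasurable_fn u) (aestronglyMeasurable_fn v)
        hu hv).norm (fun n => ?_) ?_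
    · filter_upwards [hwv n] with x hx
      rw [norm_mul, norm_mul _ (fn v x)]
      exact mul_le_mul_of_nonneg_left hx (norm_nonneg _)
    · filter_upwards [hlim] with x hx using hx.const_mul _
  refine tendsto_nhds_unique ((h1.add (h2.mono_left Nat.hyperfilter_le_atTop)).congr fun n => ?_)
    (hF f)
  obtain ⟨B, hB⟩ := hwB n
  exact h (w n) B hB

/-- Stability of the state equation. -/
theorem isAdmissible_of_limit [IsFiniteMeasure (leb Ω)] (hΩ : IsOpen Ω) {mn : ℕ → Eucl N → ℝ}
    {un : ℕ → H10 Ω} (hadm : ∀ n, IsAdmissible Ω f (mn n) (un n)) {D : ℝ}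
    (hD : ∀ n, ∫ x, mn n x * fn (un n) x ^ 2 ∂(leb Ω) ≤ D)
    {hm : ∀ n, AEStronglyMeasurable (mn n) (leb Ω)} {h0 : ∀ n, ∀ᵐ x ∂(leb Ω), 0 ≤ mn n x}
    {M : ℕ → Lp ℝ 2 (leb Ω)} {m : Eucl N → ℝ}
    (h : IsTruncLimit (hyperfilter ℕ) hm h0 M m)
    (htail : ∀ δ : ℝ, 0 < δ → ∃ k₀ : ℕ, ∀ k ≥ k₀, ∀ n,
      ∫ x, (mn n x - min (mn n x) k) ∂(leb Ω) ≤ δ)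
    {u : H10 Ω} (hu : ∀ᵐ x ∂(leb Ω), Tendsto (fun n => fn (un n) x) atTop (𝓝 (fn u x)))
    (hweak : ∀ v : H10 Ω, Tendsto (fun n => (inner ℝ v (un n) : ℝ)) atTop (𝓝 (inner ℝ v u))) :
    IsAdmissible Ω f m u := by
  have hU := Nat.hyperfilter_le_atTop
  have hi := fun n => (hadm n).1
  have hum := fun n => aestronglyMeasurable_fn (un n)
  have hw := fun n => (hadm n).2.2.1
  refine ⟨h.integrable, h.nonneg, isState_of_bounded hΩ h.integrable h.nonneg
    (h.integrable_weight hU hi htail hum hu hw hD) fun v B hB => ?_⟩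
  have h1 := (tendsto_inner_gradL2 hweak (gradL2 v)).mono_left hU
  simp only [real_inner_comm _ (gradL2 v)] at h1
  have h2 := h.tendsto_integral_mul_mul hU hi htail hum hu hw hD (aestronglyMeasurable_fn v) hB
  refine tendsto_nhds_unique ((h1.add h2).congr fun n => ?_) tendsto_const_nhds
  exact (hadm n).equation (memL2Weight_of_bounded (hi n) hB)

/-- The problem with `m = 0` has a state. -/
theorem exists_isAdmissible_zero {K : ℝ} (hK1 : 1 ≤ K)
    (hK : ∀ u : H10 Ω, ‖u‖ ^ 2 ≤ K * ‖gradL2 u‖ ^ 2) (f : Hminus1 Ω) :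
    ∃ u : H10 Ω, IsAdmissible Ω f (fun _ => 0) u := by
  set B : H10 Ω →L[ℝ] H10 Ω →L[ℝ] ℝ :=
    (innerSL ℝ).bilinearComp (gradL2CLM Ω) (gradL2CLM Ω)
  have hB : ∀ u v, B u v = inner ℝ (gradL2 u) (gradL2 v) := fun u v => rfl
  have hcoer : IsCoercive B := by
    refine ⟨K⁻¹, by positivity, fun u => ?_⟩
    rw [hB, real_inner_self_eq_norm_sq, mul_assoc, inv_mul_le_iff₀ (by positivity), ← sq]
    exact hK u
  refine ⟨hcoer.continuousLinearEquivOfBilin.symm ((InnerProductSpace.toDual ℝ _).symm f),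
    integrable_zero _ _ _, ae_of_all _ fun _ => le_rfl, ?_, fun v _ => ?_⟩
  · simp [MemL2Weight]
  · simp only [zero_mul, add_zero]
    have h1 := hcoer.continuousLinearEquivOfBilin_apply
      (hcoer.continuousLinearEquivOfBilin.symm ((InnerProductSpace.toDual ℝ _).symm f)) v
    rw [ContinuousLinearEquiv.apply_symm_apply, InnerProductSpace.toDual_symm_apply, hB,
      L2.inner_def] at h1
    exact h1.symm

end OptPot

namespace OptPot

variable {N : ℕ} {Ω : Set (Eucl N)}

theorem exists_subseq_tendsto_ae [IsFiniteMeasure (leb Ω)] {un : ℕ → H10 Ω} {C : ℝ}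
    (hC : ∀ n, ‖un n‖ ≤ C) : ∃ (u : H10 Ω) (σ : ℕ → ℕ), StrictMono σ ∧
      (∀ v : H10 Ω, Tendsto (fun n => (inner ℝ v (un (σ n)) : ℝ)) atTop (𝓝 (inner ℝ v u))) ∧
      Tendsto (fun n => toL2 (un (σ n))) atTop (𝓝 (toL2 u)) ∧
      ∀ᵐ x ∂(leb Ω), Tendsto (fun n => fn (un (σ n)) x) atTop (𝓝 (fn u x)) := by
  obtain ⟨u, φ, hφ, hweak⟩ := exists_subseq_weak_limit hC
  have hL : Tendsto (fun n => toL2 (un (φ n))) atTop (𝓝 (toL2 u)) := by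
    rw [tendsto_iff_norm_sub_tendsto_zero]
    refine tendsto_norm_toL2_of_weak (w := fun n => un (φ n) - u) (C := C + ‖u‖)
      (fun n => (norm_sub_le _ _).trans (add_le_add_left (hC _) _)) fun z => ?_
    have h1 := (tendsto_inner_toL2 hweak z).sub_const (inner ℝ z (toL2 u))
    rw [sub_self] at h1
    refine h1.congr fun n => ?_
    rw [← inner_sub_right]
    rfl
  obtain ⟨ns, hns, hae⟩ := (tendstoInMeasure_of_tendsto_Lp hL).exists_seq_tendsto_ae
  exact ⟨u, φ ∘ ns, hφ.comp hns, fun v => (hweak v).comp hns.tendsto_atTop,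
    hL.comp hns.tendsto_atTop, hae⟩

theorem integrable_fn_sq (u : H10 Ω) : Integrable (fun x => fn u x ^ 2) (leb Ω) :=
  (Lp.memLp (toL2 u)).integrable_sq

theorem integral_fn_sq (u : H10 Ω) : ∫ x, fn u x ^ 2 ∂(leb Ω) = ‖toL2 u‖ ^ 2 := by
  rw [← real_inner_self_eq_norm_sq, L2.inner_def]
  refine integral_congr_ae (ae_of_all _ fun x => ?_)
  simp [fn, sq]

/-- The sublevels of the cost are closed along minimizing sequences. -/
theorem exists_cost_le_of_seq (hΩ : IsOpen Ω) [IsFiniteMeasure (leb Ω)] {j : Eucl N → ℝ → ℝ}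
    (hj_lsc : ∀ᵐ x ∂(leb Ω), LowerSemicontinuous (j x)) {a : Eucl N → ℝ}
    (ha : Integrable a (leb Ω)) {c : ℝ} (hc : 0 ≤ c)
    (hj_bound : ∀ᵐ x ∂(leb Ω), ∀ s : ℝ, a x - c * |s| ^ 2 ≤ j x s) {ψ : ℝ → ℝ≥0∞}
    (hψ_conv : ConvexOn ℝ≥0 univ ψ) (hψ_lsc : LowerSemicontinuous ψ)
    (hψ_super : Tendsto (fun s : ℝ => ψ s / ENNReal.ofReal s) atTop (𝓝 ⊤)) {f : Hminus1 Ω}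
    {K : ℝ} (hK1 : 1 ≤ K) (hK : ∀ u : H10 Ω, ‖u‖ ^ 2 ≤ K * ‖gradL2 u‖ ^ 2)
    {mn : ℕ → Eucl N → ℝ} {un : ℕ → H10 Ω} (hadm : ∀ n, IsAdmissible Ω f (mn n) (un n))
    {A : ℕ → ℝ} (hA : Antitone A) (hcost : ∀ n, cost Ω j ψ (un n) (mn n) < (A n : EReal)) :
    ∃ m u, IsAdmissible Ω f m u ∧ ∀ n, cost Ω j ψ u m ≤ (A n : EReal) := by
  set b : H10 Ω → Eucl N → ℝ := fun v x => c * fn v x ^ 2 - a x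
  have hb : ∀ v, Integrable (b v) (leb Ω) := fun v => ((integrable_fn_sq v).const_mul c).sub ha
  have hbint : ∀ v, ∫ x, b v x ∂(leb Ω) = c * ‖toL2 v‖ ^ 2 - ∫ x, a x ∂(leb Ω) := fun v => by
    simp only [b]
    rw [integral_sub ((integrable_fn_sq v).const_mul c) ha, integral_const_mul, integral_fn_sq]
  have hjb : ∀ v : H10 Ω, ∀ᵐ x ∂(leb Ω), 0 ≤ j x (fn v x) + b v x := fun v => by
    filter_upwards [hj_bound] with x hx
    have := hx (fn v x)
    rw [sq_abs] at this
    simp only [b]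
    linarith
  have hbound := fun n => ((hadm n).energy_le hK1 hK).1
  obtain ⟨u, σ, hσ, hweak, hL, hae⟩ := exists_subseq_tendsto_ae hbound
  have hex : ∀ n, ∃ r : Eucl N → ℝ, Integrable r (leb Ω) ∧
      (∀ᵐ x ∂(leb Ω), ((j x (fn (un n) x) : ℝ) : EReal) + (ψ (mn n x) : EReal) ≤ (r x : EReal)) ∧
      ∫ x, r x ∂(leb Ω) ≤ A n := fun n => by
    refine exists_integrable_of_upperIntegral_lt (hb (un n)) ?_ (hcost n)
    filter_upwards [hjb (un n)] with x hx
    have h1 : -b (un n) x ≤ j x (fn (un n) x) := by linarith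
    exact (EReal.coe_le_coe_iff.2 h1).trans (le_add_of_nonneg_right (EReal.coe_ennreal_nonneg _))
  choose r hri hyr hrA using hex
  set C : ℝ≥0∞ := ENNReal.ofReal (A 0 + (c * (K * ‖f‖) ^ 2 - ∫ x, a x ∂(leb Ω)))
  have hψC : ∀ n, ∫⁻ x, ψ (mn n x) ∂(leb Ω) ≤ C := fun n => by
    refine (lintegral_le_of_coe_add_le (hb (un n)) (hri n) (hjb (un n)) (hyr n)).2.2.trans ?_
    refine ENNReal.ofReal_le_ofReal (add_le_add ((hrA n).trans (hA (Nat.zero_le n))) ?_)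
    rw [hbint]
    gcongr
    exact (norm_toL2_le _).trans (hbound n)
  have htail : ∀ δ : ℝ, 0 < δ → ∃ k₀ : ℕ, ∀ k ≥ k₀, ∀ n,
      ∫ x, (mn n x - min (mn n x) k) ∂(leb Ω) ≤ δ := fun δ hδ => by
    obtain ⟨k₀, hk₀⟩ := exists_tail_le_of_superlinear (μ := leb Ω) hψ_super
      (C := C) ENNReal.ofReal_ne_top hδ
    exact ⟨k₀, fun k hk n => hk₀ k hk (mn n) (hadm n).1.1 (hψC n)⟩
  obtain ⟨k, hk⟩ := htail 1 one_pos
  have hL1 : ∀ n, ∫ x, mn n x ∂(leb Ω) ≤ 1 + (leb Ω).real univ * k := fun n => by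
    have hmin : Integrable (fun x => min (mn n x) (k : ℝ)) (leb Ω) :=
      (memLp_min_natCast (hadm n).1.1 (hadm n).2.1 k).integrable (by norm_num)
    have h1 := hk k le_rfl n
    rw [integral_sub (hadm n).1 hmin] at h1
    have h2 : ∫ x, min (mn n x) (k : ℝ) ∂(leb Ω) ≤ ∫ _, (k : ℝ) ∂(leb Ω) :=
      integral_mono hmin (integrable_const _) fun x => min_le_right _ _
    rw [integral_const, smul_eq_mul] at h2
    linarith
  obtain ⟨M, m, hm⟩ := exists_truncLimit (hyperfilter ℕ) (fun n => (hadm (σ n)).1)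
    (fun n => (hadm (σ n)).2.1) (fun n => hL1 (σ n))
  refine ⟨m, u, isAdmissible_of_limit hΩ (fun n => hadm (σ n))
    (fun n => ((hadm (σ n)).energy_le hK1 hK).2) hm
    (fun δ hδ => (htail δ hδ).imp fun k₀ h k hk n => h k hk (σ n)) hae hweak, fun n₀ => ?_⟩
  refine upperIntegral_le_of_liminf Nat.hyperfilter_le_atTop hψ_lsc.measurable
    (y := fun n x => j x (fn (un (σ n)) x)) (b := fun n => b (un (σ n))) (r := fun n => r (σ n))
    (mn := fun n => mn (σ n)) (b₀ := b u) (fun n => (hadm (σ n)).1.1.aemeasurable)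
    hm.integrable.1.aemeasurable (fun n => hb _) (hb u) ?_ (fun n => hjb _) (hjb u) ?_
    (fun n => hri _) (fun n => hyr _) (fun B hB => hm.lintegral_le hψ_conv hψ_lsc hψ_super hB) ?_
  · simp only [hbint]
    exact ((hL.norm.pow 2).const_mul c).sub_const _
  · filter_upwards [hj_lsc, hae] with x h1 h2
    have h3 : LowerSemicontinuous fun s => ENNReal.ofReal (j x s + (c * s ^ 2 - a x)) :=
      ENNReal.continuous_ofReal.comp_lowerSemicontinuous
        (h1.add (Continuous.lowerSemicontinuous (by fun_prop)))
        (fun _ _ h => ENNReal.ofReal_le_ofReal h)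
    exact (LowerSemicontinuousAt.le_liminf (h3 (fn u x))).trans h2.liminf_le_liminf_comp
  · filter_upwards [eventually_ge_atTop n₀] with n hn
    exact (hrA _).trans (hA (hn.trans (hσ.id_le n)))

end OptPot

theorem theorem4p1 (N : ℕ) (hN : 1 ≤ N) (Ω : Set (OptPot.Eucl N))
    (hΩ : IsOpen Ω) (hΩb : Bornology.IsBounded Ω)
    (j : OptPot.Eucl N → ℝ → ℝ)
    (hj_meas : ∀ s : ℝ, AEMeasurable (fun x => j x s) (OptPot.leb Ω))
    (hj_lsc : ∀ᵐ x ∂(OptPot.leb Ω), LowerSemicontinuous (j x))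
    (a : OptPot.Eucl N → ℝ) (ha : Integrable a (OptPot.leb Ω)) (c : ℝ) (hc : 0 ≤ c)
    (hj_bound : ∀ᵐ x ∂(OptPot.leb Ω), ∀ s : ℝ, a x - c * |s| ^ 2 ≤ j x s)
    (ψ : ℝ → ℝ≥0∞)
    (hψ_conv : ConvexOn ℝ≥0 Set.univ ψ)
    (hψ_lsc : LowerSemicontinuous ψ)
    (hψ_dom : ∀ s : ℝ, ψ s < ⊤ → 0 ≤ s)
    (hψ_super : Tendsto (fun s : ℝ => ψ s / ENNReal.ofReal s) atTop (𝓝 ⊤))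
    (f : OptPot.Hminus1 Ω) :
    ∃ m : OptPot.Eucl N → ℝ, OptPot.IsOptimalPotential Ω j ψ f m := by
  have hfin : IsFiniteMeasure (OptPot.leb Ω) :=
    ⟨by rw [Measure.restrict_apply_univ]; exact hΩb.measure_lt_top⟩
  obtain ⟨K, hK1, hK⟩ := OptPot.exists_poincare hN hΩ.measurableSet hΩb
  set S : Set EReal := {y | ∃ m u, OptPot.IsAdmissible Ω f m u ∧ OptPot.cost Ω j ψ u m = y}
  have hle : ∀ m u, OptPot.IsAdmissible Ω f m u → sInf S ≤ OptPot.cost Ω j ψ u m :=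
    fun m u h => sInf_le ⟨m, u, h, rfl⟩
  rcases eq_or_lt_of_le (le_top (a := sInf S)) with htop | hlt
  · obtain ⟨u, hu⟩ := OptPot.exists_isAdmissible_zero hK1 hK f
    exact ⟨_, u, hu, fun m' u' h' => le_top.trans (htop ▸ hle m' u' h')⟩
  · obtain ⟨y, hy, hyI, hylim⟩ := exists_seq_strictAnti_tendsto' hlt
    have hcoe : ∀ n, ((y n).toReal : EReal) = y n := fun n =>
      EReal.coe_toReal (hyI n).2.ne (bot_le.trans_lt (hyI n).1).ne'
    have hex : ∀ n, ∃ m u, OptPot.IsAdmissible Ω f m u ∧ OptPot.cost Ω j ψ u m < y n := fun n => by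
      obtain ⟨_, ⟨m, u, h1, rfl⟩, h2⟩ := sInf_lt_iff.1 (hyI n).1
      exact ⟨m, u, h1, h2⟩
    choose mn un hadm hcost using hex
    obtain ⟨m, u, hmu, hmin⟩ := OptPot.exists_cost_le_of_seq hΩ hj_lsc ha hc hj_bound hψ_conv hψ_lsc
      hψ_super hK1 hK hadm (A := fun n => (y n).toReal)
      (fun k l hkl => EReal.coe_le_coe_iff.1 (by rw [hcoe, hcoe]; exact hy.antitone hkl))
      (fun n => by rw [hcoe]; exact hcost n)
    refine ⟨m, u, hmu, fun m' u' h' => le_trans ?_ (hle m' u' h')⟩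
    exact ge_of_tendsto' hylim fun n => hcoe n ▸ hmin n
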